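/- Let $\mathcal{A}$ be a set of action names, with co-names $\overline{\mathcal{A}}$, and let $\mathcal{A}_\tau=\mathcal{A}\cup\overline{\mathcal{A}}\cup\{\tau\}$. CCS terms are given by $t::=\mathbf{0}\mid x\mid \mu.t\mid t+t\mid t\,\|\,t$, where $x$ ranges over a countably infinite set of variables and $\mu\in\mathcal{A}_\tau$, with the usual operational rules, where $\|$ also allows complementary actions $c,\overline{c}$ to synchronise into $\tau$. Terms are considered modulo associativity and commutativity of $+$; processes are closed terms. If $t=t_1+\dots+t_k$ and no $t_i$ has $+$ as head operator, then the $t_i$ are the summands of $t$. The size of a term is its number of operator symbols (the constant $\mathbf{0}$ not being counted). A possible future of a process $p$ is a pair $(\varphi,X)$ with $\varphi\in\mathcal{A}_\tau^*$ and $X\subseteq\mathcal{A}_\tau^*$ such that $p\xrightarrow{\varphi}p'$ for some $p'$ whose set of traces is $X$; $p\sim_{\mathtt{PF}}q$ means that $p$ and $q$ have the same possible futures. An equation $t\approx u$ is sound modulo $\sim_{\mathtt{PF}}$ if $\sigma(t)\sim_{\mathtt{PF}}\sigma(u)$ for all closed substitutions $\sigma$, and an axiom system (a set of equations) is sound if all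 its equations are. $\mathcal{E}\vdash t\approx u$ means that $t\approx u$ is derivable from $\mathcal{E}$ by the rules of equational logic. Let $a,b\in\mathcal{A}$ with $a\neq b$, and for $N\ge 1$ let $p_N=\sum_{i=1}^N b^i a$, where $b^i a$ denotes $\underbrace{b.\cdots.b.}_{i}a.\mathbf{0}$; below, $a$ also denotes the process $a.\mathbf{0}$. **Theorem.** Let $\mathcal{E}$ be a finite axiom system over CCS that is sound modulo $\sim_{\mathtt{PF}}$. Let $N\ge 1$ be larger than the size of each term in the equations in $\mathcal{E}$. Let $p$ and $q$ be processes with $p\sim_{\mathtt{PF}}a\,\|\,p_N$ and $q\sim_{\mathtt{PF}}a\,\|\,p_N$, and suppose that $\mathcal{E}\vdash p\approx q$. If $p$ has a summand that is possible futures equivalent to $a\,\|\,p_N$ and that is not of the form $r\,\|\,s$ with $r\sim_{\mathtt{PF}}\mathbf{0}$ or $s\sim_{\mathtt{PF}}\mathbf{0}$, then $q$ has a summand that is possible futures equivalent to $a\,\|\,p_N$. -/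

import Mathlib

namespace CCS

/-- Actions over a set `A` of action names: names, co-names and the silent action. -/
inductive Act (A : Type*) where
  | name (a : A)
  | coname (a : A)
  | tau

/-- Terms of the recursion, restriction and relabelling free fragment of CCS. Process variables
are indexed by `ℕ`. Terms are raw syntax; the identification of terms up to associativity and
commutativity of `+` is built into `Derivable` below (summands, size and transitions do not
distinguish identified terms). -/
inductive Term (A : Type*) where
  | zero
  | var (x : ℕ)
  | pre (μ : Act A) (t : Term A)
  | add (t u : Term A)
  | par (t u : Term A)

namespace Term

variable {A : Type*}

/-- A closed term (a process) has no variables. -/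
def Closed : Term A → Prop
  | zero => True
  | var _ => False
  | pre _ t => t.Closed
  | add t u => t.Closed ∧ u.Closed
  | par t u => t.Closed ∧ u.Closed

/-- The number of operator symbols in a term. The constant `0` is not counted; counting it would
only make sizes larger. -/
def size : Term A → ℕ
  | zero => 0
  | var _ => 0
  | pre _ t => t.size + 1
  | add t u => t.size + u.size + 1
  | par t u => t.size + u.size + 1

/-- Application of a substitution to a term. -/
def subst (σ : ℕ → Term A) : Term A → Term A
  | zero => zero
  | var x => σ x
  | pre μ t => pre μ (t.subst σ)
  | add t u => add (t.subst σ) (u.subst σ)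
  | par t u => par (t.subst σ) (u.subst σ)

/-- The summands of `t = t₁ + ⋯ + tₖ`, where no `tᵢ` has `+` as head operator. -/
def summands : Term A → Set (Term A)
  | add t u => t.summands ∪ u.summands
  | t => {t}

/-- `t₁ + ⋯ + tₖ`; the empty sum is `0`. -/
def sum : List (Term A) → Term A
  | [] => zero
  | [t] => t
  | t :: u :: ts => add t (sum (u :: ts))

/-- `μ ⋯ μ . t`, with `n` occurrences of `μ`. -/
def prePow (μ : Act A) : ℕ → Term A → Term A
  | 0, t => t
  | n + 1, t => pre μ (prePow μ n t)

end Term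

open Term

variable {A : Type*}

/-- The transitions derivable from the SOS rules. (Variables have no transitions; only the
transitions of closed terms are used.) -/
inductive Step : Term A → Act A → Term A → Prop where
  | pre (μ : Act A) (t : Term A) : Step (pre μ t) μ t
  | addL {t u t' : Term A} {μ : Act A} : Step t μ t' → Step (add t u) μ t'
  | addR {t u u' : Term A} {μ : Act A} : Step u μ u' → Step (add t u) μ u'
  | parL {t u t' : Term A} {μ : Act A} : Step t μ t' → Step (par t u) μ (par t' u)
  | parR {t u u' : Term A} {μ : Act A} : Step u μ u' → Step (par t u) μ (par t u')
  | syncL {t u t' u' : Term A} {c : A} : Step t (Act.name c) t' → Step u (Act.coname c) u' →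
      Step (par t u) Act.tau (par t' u')
  | syncR {t u t' u' : Term A} {c : A} : Step t (Act.coname c) t' → Step u (Act.name c) u' →
      Step (par t u) Act.tau (par t' u')

/-- `Steps p φ p'`: the process `p` can perform the sequence of actions `φ` and become `p'`. -/
inductive Steps : Term A → List (Act A) → Term A → Prop where
  | nil (p : Term A) : Steps p [] p
  | cons {p p' p'' : Term A} {μ : Act A} {φ : List (Act A)} :
      Step p μ p' → Steps p' φ p'' → Steps p (μ :: φ) p''

/-- The set of traces of `p`. -/
def traces (p : Term A) : Set (List (Act A)) :=
  {φ | ∃ p', Steps p φ p'}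

/-- The possible futures of `p`: pairs of a trace leading to some `p'` and the set of traces of
`p'`. -/
def possibleFutures (p : Term A) : Set (List (Act A) × Set (List (Act A))) :=
  {fX | ∃ p', Steps p fX.1 p' ∧ fX.2 = traces p'}

/-- Possible futures equivalence. -/
def PFEquiv (p q : Term A) : Prop :=
  possibleFutures p = possibleFutures q

/-- Soundness of the equation `t ≈ u` modulo possible futures equivalence. -/
def SoundPF (t u : Term A) : Prop :=
  ∀ σ : ℕ → Term A, (∀ x, (σ x).Closed) → PFEquiv (t.subst σ) (u.subst σ)

/-- Provability of equations from the axiom system `E` in equational logic, over terms modulo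
associativity and commutativity of `+` (rules `addComm` and `addAssoc`). -/
inductive Derivable (E : Set (Term A × Term A)) : Term A → Term A → Prop where
  | ax {t u : Term A} : (t, u) ∈ E → Derivable E t u
  | addComm (t u : Term A) : Derivable E (add t u) (add u t)
  | addAssoc (t u v : Term A) : Derivable E (add (add t u) v) (add t (add u v))
  | refl (t : Term A) : Derivable E t t
  | symm {t u : Term A} : Derivable E t u → Derivable E u t
  | trans {t u v : Term A} : Derivable E t u → Derivable E u v → Derivable E t v
  | subst (σ : ℕ → Term A) {t u : Term A} : Derivable E t u →
      Derivable E (t.subst σ) (u.subst σ)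
  | pre (μ : Act A) {t u : Term A} : Derivable E t u → Derivable E (pre μ t) (pre μ u)
  | add {t u t' u' : Term A} : Derivable E t u → Derivable E t' u' →
      Derivable E (add t t') (add u u')
  | par {t u t' u' : Term A} : Derivable E t u → Derivable E t' u' →
      Derivable E (par t t') (par u u')

/-- The one-step process `a`, that is `a.0`. -/
def act (a : A) : Term A :=
  pre (Act.name a) zero

/-- `p_N = b a + b² a + ⋯ + b^N a`. -/
def pN (a b : A) (N : ℕ) : Term A :=
  Term.sum ((List.range N).map fun i => prePow (Act.name b) (i + 1) (act a))

end CCS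

/-! The invariant carried through a derivation is `HasSummand (target a b N)`. It peels off
terminated parallel components, so that sound laws such as x ≈ x ‖ 0 do not disturb it. The heart of
the matter is one closed instance σ(t) ≈ σ(u) of an axiom with σ(t) equivalent to a ‖ p_N, treated
in `SoundPF.hasSummand`.

Peeling σ(t) ends either at a variable x of t or at a parallel composition t₁ ‖ t₂ in t whose
instance is equivalent to a ‖ p_N and has no terminated factor. In the second case, nothing can
follow a word bⁱa in p_N, so the traces of p_N do not split over two active components. Hence one
factor terminates by performing a, and the other has the traces of p_N
(`canFinish_or_of_pfEquiv_target`, `traces_right_factor`). The latter has N different trace sets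
after b, but the corresponding part of t has fewer than N operator symbols. So that part has a
variable x as a summand, with σ(x) not terminated (`exists_reach_var_of_factor`). This is where the
bound on the axiom sizes enters.

Soundness is then applied to another substitution: σ(x) receives an extra summand bᵐ, with m larger
than the size of σ(u). This marks x. Possible futures detect completed traces, and u can match the
completed trace bᵐ only if x is a summand of u. It can match bᵐa only if x is a summand of one
factor of a parallel composition in u whose other factor terminates by a
(`reach_var_of_completes_replicate`, `exists_reach_par_of_completes_word`). In the first case u
inherits the summand from σ(x). In the second, the instance of the composition found in u has only
proper futures of a ‖ p_N, and a factor terminating by a makes it equivalent to a ‖ p_N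
(`pfEquiv_target_of_canFinish`). -/

namespace CCS

open Term

variable {A : Type*}

/-! ### Interleaving of traces -/

/-- `Merge φ₁ φ₂ φ`: parallel components performing `φ₁` and `φ₂` can jointly perform `φ`. -/
inductive Merge : List (Act A) → List (Act A) → List (Act A) → Prop where
  | nil : Merge [] [] []
  | left {μ : Act A} {φ₁ φ₂ φ : List (Act A)} : Merge φ₁ φ₂ φ → Merge (μ :: φ₁) φ₂ (μ :: φ)
  | right {μ : Act A} {φ₁ φ₂ φ : List (Act A)} : Merge φ₁ φ₂ φ → Merge φ₁ (μ :: φ₂) (μ :: φ)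
  | syncL {c : A} {φ₁ φ₂ φ : List (Act A)} : Merge φ₁ φ₂ φ →
      Merge (Act.name c :: φ₁) (Act.coname c :: φ₂) (Act.tau :: φ)
  | syncR {c : A} {φ₁ φ₂ φ : List (Act A)} : Merge φ₁ φ₂ φ →
      Merge (Act.coname c :: φ₁) (Act.name c :: φ₂) (Act.tau :: φ)

namespace Merge

theorem symm {φ₁ φ₂ φ : List (Act A)} (h : Merge φ₁ φ₂ φ) : Merge φ₂ φ₁ φ := by
  induction h with
  | nil => exact nil
  | left _ ih => exact right ih
  | right _ ih => exact left ih
  | syncL _ ih => exact syncR ih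
  | syncR _ ih => exact syncL ih

theorem nil_left (φ : List (Act A)) : Merge [] φ φ := by
  induction φ with
  | nil => exact nil
  | cons μ φ ih => exact right ih

theorem eq_of_nil_left {φ₂ φ : List (Act A)} (h : Merge [] φ₂ φ) : φ = φ₂ := by
  induction φ₂ generalizing φ with
  | nil => cases h; rfl
  | cons μ φ₂ ih => cases h with | right h => rw [ih h]

theorem append (φ₁ φ₂ : List (Act A)) : Merge φ₁ φ₂ (φ₁ ++ φ₂) := by
  induction φ₁ with
  | nil => exact nil_left φ₂
  | cons μ φ₁ ih => exact left ih

/-- Without co-names there is no synchronisation, so a merge is a plain shuffle and occurrences of a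
and b can be counted. -/
theorem perm {φ₁ φ₂ φ : List (Act A)} (h : Merge φ₁ φ₂ φ)
    (h₁ : ∀ c, Act.coname c ∉ φ₁) (h₂ : ∀ c, Act.coname c ∉ φ₂) : φ.Perm (φ₁ ++ φ₂) := by
  induction h with
  | nil => exact List.Perm.refl _
  | left _ ih =>
    exact (ih (fun c hc => h₁ c (List.mem_cons_of_mem _ hc)) h₂).cons _
  | right _ ih =>
    exact ((ih h₁ (fun c hc => h₂ c (List.mem_cons_of_mem _ hc))).cons _).trans
      List.perm_middle.symm
  | @syncL c => exact absurd List.mem_cons_self (h₂ c)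
  | @syncR c => exact absurd List.mem_cons_self (h₁ c)

end Merge

/-- The word `b ⋯ b a` with `n` occurrences of `b`. -/
def word (a b : A) (n : ℕ) : List (Act A) :=
  List.replicate n (Act.name b) ++ [Act.name a]

theorem word_zero (a b : A) : word a b 0 = [Act.name a] := rfl

theorem word_succ (a b : A) (n : ℕ) : word a b (n + 1) = Act.name b :: word a b n := rfl

theorem Merge.of_replicate {b : A} {φ₁ φ₂ : List (Act A)} {n : ℕ}
    (h : Merge φ₁ φ₂ (List.replicate n (Act.name b))) :
    ∃ i j, i + j = n ∧ φ₁ = List.replicate i (Act.name b) ∧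
      φ₂ = List.replicate j (Act.name b) := by
  induction n generalizing φ₁ φ₂ with
  | zero => cases h; exact ⟨0, 0, rfl, rfl, rfl⟩
  | succ n ih =>
    rw [List.replicate_succ] at h
    cases h with
    | left h =>
      obtain ⟨i, j, hij, rfl, rfl⟩ := ih h
      exact ⟨i + 1, j, by omega, rfl, rfl⟩
    | right h =>
      obtain ⟨i, j, hij, rfl, rfl⟩ := ih h
      exact ⟨i, j + 1, by omega, rfl, rfl⟩

theorem Merge.of_word {a b : A} {φ₁ φ₂ : List (Act A)} {n : ℕ}
    (h : Merge φ₁ φ₂ (word a b n)) :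
    ∃ i j, i + j = n ∧ ((φ₁ = word a b i ∧ φ₂ = List.replicate j (Act.name b)) ∨
      (φ₁ = List.replicate i (Act.name b) ∧ φ₂ = word a b j)) := by
  induction n generalizing φ₁ φ₂ with
  | zero =>
    rw [word_zero] at h
    cases h with
    | left h => cases h; exact ⟨0, 0, rfl, Or.inl ⟨rfl, rfl⟩⟩
    | right h => cases h; exact ⟨0, 0, rfl, Or.inr ⟨rfl, rfl⟩⟩
  | succ n ih =>
    rw [word_succ] at h
    cases h with
    | left h =>
      obtain ⟨i, j, hij, h | h⟩ := ih h <;> obtain ⟨rfl, rfl⟩ := h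
      · exact ⟨i + 1, j, by omega, Or.inl ⟨rfl, rfl⟩⟩
      · exact ⟨i + 1, j, by omega, Or.inr ⟨rfl, rfl⟩⟩
    | right h =>
      obtain ⟨i, j, hij, h | h⟩ := ih h <;> obtain ⟨rfl, rfl⟩ := h
      · exact ⟨i, j + 1, by omega, Or.inl ⟨rfl, rfl⟩⟩
      · exact ⟨i, j + 1, by omega, Or.inr ⟨rfl, rfl⟩⟩

theorem length_word (a b : A) (n : ℕ) : (word a b n).length = n + 1 := by simp [word]

theorem eq_of_word_append_prefix {a b : A} (hab : a ≠ b) {i n : ℕ} {ψ : List (Act A)}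
    (h : word a b i ++ ψ <+: word a b n) : i = n ∧ ψ = [] := by
  induction i generalizing n with
  | zero =>
    cases n with
    | zero => simpa [word] using h
    | succ n => simp [word, List.replicate_succ, hab] at h
  | succ i ih =>
    cases n with
    | zero => simp [word, List.replicate_succ, hab.symm] at h
    | succ n =>
      rw [word_succ, word_succ, List.cons_append, List.cons_prefix_cons] at h
      obtain ⟨rfl, rfl⟩ := ih h.2
      exact ⟨rfl, rfl⟩

theorem prefix_word_iff {a b : A} {φ : List (Act A)} {n : ℕ} :
    φ <+: word a b n ↔ (∃ k ≤ n, φ = List.replicate k (Act.name b)) ∨ φ = word a b n := by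
  induction n generalizing φ with
  | zero =>
    cases φ with
    | nil => simp [word]
    | cons μ φ => simp [word, List.cons_prefix_cons]
  | succ n ih =>
    cases φ with
    | nil => exact ⟨fun _ => Or.inl ⟨0, Nat.zero_le _, rfl⟩, fun _ => List.nil_prefix⟩
    | cons μ φ =>
      rw [word_succ, List.cons_prefix_cons, ih]
      constructor
      · rintro ⟨rfl, ⟨k, hk, rfl⟩ | rfl⟩
        · exact Or.inl ⟨k + 1, by omega, rfl⟩
        · exact Or.inr rfl
      · rintro (⟨k, hk, h⟩ | h)
        · cases k with
          | zero => simp at h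
          | succ k =>
            rw [List.replicate_succ, List.cons.injEq] at h
            exact ⟨h.1, Or.inl ⟨k, by omega, h.2⟩⟩
        · rw [List.cons.injEq] at h
          exact ⟨h.1, Or.inr h.2⟩

theorem coname_notMem_word (a b c : A) (n : ℕ) : Act.coname c ∉ word a b n := by
  simp [word, List.mem_replicate]

/-! ### Transition sequences and traces -/

theorem Steps.of_append {p r : Term A} {φ ψ : List (Act A)} (h : Steps p (φ ++ ψ) r) :
    ∃ q, Steps p φ q ∧ Steps q ψ r := by
  induction φ generalizing p with
  | nil => exact ⟨p, Steps.nil p, h⟩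
  | cons μ φ ih =>
    cases h with
    | cons hs h =>
      obtain ⟨q, h₁, h₂⟩ := ih h
      exact ⟨q, Steps.cons hs h₁, h₂⟩

theorem steps_nil {p q : Term A} : Steps p [] q ↔ q = p := by
  constructor
  · intro h; cases h; rfl
  · rintro rfl; exact Steps.nil _

theorem steps_cons {p q : Term A} {μ : Act A} {φ : List (Act A)} :
    Steps p (μ :: φ) q ↔ ∃ p', Step p μ p' ∧ Steps p' φ q := by
  constructor
  · intro h; cases h with | cons h₁ h₂ => exact ⟨_, h₁, h₂⟩
  · rintro ⟨p', h₁, h₂⟩; exact Steps.cons h₁ h₂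

theorem steps_singleton {p q : Term A} {μ : Act A} : Steps p [μ] q ↔ Step p μ q := by
  simp [steps_cons, steps_nil]

theorem steps_par_iff {p q w : Term A} {φ : List (Act A)} :
    Steps (par p q) φ w ↔ ∃ φ₁ φ₂ p' q', Merge φ₁ φ₂ φ ∧ Steps p φ₁ p' ∧ Steps q φ₂ q' ∧
      w = par p' q' := by
  constructor
  · intro h
    induction φ generalizing p q with
    | nil =>
      rw [steps_nil] at h
      exact ⟨[], [], p, q, Merge.nil, Steps.nil p, Steps.nil q, h⟩
    | cons μ φ ih =>
      obtain ⟨v, hv, h⟩ := steps_cons.1 h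
      cases hv with
      | parL hs =>
        obtain ⟨φ₁, φ₂, p', q', hm, h₁, h₂, rfl⟩ := ih h
        exact ⟨_, _, _, _, hm.left, Steps.cons hs h₁, h₂, rfl⟩
      | parR hs =>
        obtain ⟨φ₁, φ₂, p', q', hm, h₁, h₂, rfl⟩ := ih h
        exact ⟨_, _, _, _, hm.right, h₁, Steps.cons hs h₂, rfl⟩
      | syncL hs hs' =>
        obtain ⟨φ₁, φ₂, p', q', hm, h₁, h₂, rfl⟩ := ih h
        exact ⟨_, _, _, _, hm.syncL, Steps.cons hs h₁, Steps.cons hs' h₂, rfl⟩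
      | syncR hs hs' =>
        obtain ⟨φ₁, φ₂, p', q', hm, h₁, h₂, rfl⟩ := ih h
        exact ⟨_, _, _, _, hm.syncR, Steps.cons hs h₁, Steps.cons hs' h₂, rfl⟩
  · rintro ⟨φ₁, φ₂, p', q', hm, h₁, h₂, rfl⟩
    induction hm generalizing p q with
    | nil => rw [steps_nil] at h₁ h₂; subst h₁ h₂; exact Steps.nil _
    | left _ ih =>
      obtain ⟨v, hv, h₁⟩ := steps_cons.1 h₁
      exact Steps.cons (Step.parL hv) (ih h₁ h₂)
    | right _ ih =>
      obtain ⟨v, hv, h₂⟩ := steps_cons.1 h₂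
      exact Steps.cons (Step.parR hv) (ih h₁ h₂)
    | syncL _ ih =>
      obtain ⟨v, hv, h₁⟩ := steps_cons.1 h₁
      obtain ⟨v', hv', h₂⟩ := steps_cons.1 h₂
      exact Steps.cons (Step.syncL hv hv') (ih h₁ h₂)
    | syncR _ ih =>
      obtain ⟨v, hv, h₁⟩ := steps_cons.1 h₁
      obtain ⟨v', hv', h₂⟩ := steps_cons.1 h₂
      exact Steps.cons (Step.syncR hv hv') (ih h₁ h₂)

theorem nil_mem_traces (p : Term A) : [] ∈ traces p := ⟨p, Steps.nil p⟩

theorem cons_mem_traces {p : Term A} {μ : Act A} {φ : List (Act A)} :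
    μ :: φ ∈ traces p ↔ ∃ p', Step p μ p' ∧ φ ∈ traces p' := by
  constructor
  · rintro ⟨w, h⟩
    obtain ⟨p', h₁, h₂⟩ := steps_cons.1 h
    exact ⟨p', h₁, w, h₂⟩
  · rintro ⟨p', h₁, w, h₂⟩
    exact ⟨w, Steps.cons h₁ h₂⟩

theorem mem_traces_of_prefix {p : Term A} {φ ψ : List (Act A)} (h : φ <+: ψ)
    (hψ : ψ ∈ traces p) : φ ∈ traces p := by
  obtain ⟨θ, rfl⟩ := h
  obtain ⟨w, hw⟩ := hψ
  obtain ⟨v, hv, -⟩ := hw.of_append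
  exact ⟨v, hv⟩

theorem mem_traces_par {p q : Term A} {φ : List (Act A)} :
    φ ∈ traces (par p q) ↔ ∃ φ₁ ∈ traces p, ∃ φ₂ ∈ traces q, Merge φ₁ φ₂ φ := by
  constructor
  · rintro ⟨w, h⟩
    obtain ⟨φ₁, φ₂, p', q', hm, h₁, h₂, -⟩ := steps_par_iff.1 h
    exact ⟨φ₁, ⟨p', h₁⟩, φ₂, ⟨q', h₂⟩, hm⟩
  · rintro ⟨φ₁, ⟨p', h₁⟩, φ₂, ⟨q', h₂⟩, hm⟩
    exact ⟨_, steps_par_iff.2 ⟨φ₁, φ₂, p', q', hm, h₁, h₂, rfl⟩⟩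

theorem traces_par_congr {p p' q q' : Term A} (hp : traces p = traces p')
    (hq : traces q = traces q') : traces (par p q) = traces (par p' q') := by
  ext φ
  rw [mem_traces_par, mem_traces_par, hp, hq]

theorem traces_par_comm (p q : Term A) : traces (par p q) = traces (par q p) := by
  ext φ
  rw [mem_traces_par, mem_traces_par]
  constructor <;> rintro ⟨φ₁, h₁, φ₂, h₂, hm⟩ <;> exact ⟨φ₂, h₂, φ₁, h₁, hm.symm⟩

/-! ### Terminated processes -/

/-- A process without transitions. -/
def Done (p : Term A) : Prop := ∀ μ p', ¬ Step p μ p'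

theorem done_zero : Done (zero : Term A) := by intro μ p' h; cases h

theorem not_done_pre (μ : Act A) (p : Term A) : ¬ Done (pre μ p) := fun h => h _ _ (Step.pre μ p)

theorem done_add {p q : Term A} : Done (Term.add p q) ↔ Done p ∧ Done q := by
  constructor
  · exact fun h => ⟨fun μ p' hs => h μ p' (Step.addL hs), fun μ p' hs => h μ p' (Step.addR hs)⟩
  · rintro ⟨hp, hq⟩ μ p' hs
    cases hs with
    | addL hs => exact hp _ _ hs
    | addR hs => exact hq _ _ hs

theorem done_par {p q : Term A} : Done (par p q) ↔ Done p ∧ Done q := by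
  constructor
  · exact fun h => ⟨fun μ p' hs => h μ _ (Step.parL hs), fun μ p' hs => h μ _ (Step.parR hs)⟩
  · rintro ⟨hp, hq⟩ μ p' hs
    cases hs with
    | parL hs => exact hp _ _ hs
    | parR hs => exact hq _ _ hs
    | syncL hs _ => exact hp _ _ hs
    | syncR hs _ => exact hp _ _ hs

theorem Done.steps {p q : Term A} {φ : List (Act A)} (hp : Done p) (h : Steps p φ q) :
    φ = [] ∧ q = p := by
  cases h with
  | nil => exact ⟨rfl, rfl⟩
  | cons hs _ => exact absurd hs (hp _ _)

theorem done_iff_traces {p : Term A} : Done p ↔ traces p = {[]} := by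
  constructor
  · intro h
    ext φ
    constructor
    · rintro ⟨w, hw⟩; exact (h.steps hw).1
    · rintro rfl; exact nil_mem_traces p
  · intro h μ p' hs
    have : [μ] ∈ traces p := cons_mem_traces.2 ⟨p', hs, nil_mem_traces p'⟩
    rw [h] at this
    simp at this

theorem exists_singleton_mem_traces {p : Term A} (h : ¬ Done p) : ∃ μ, [μ] ∈ traces p := by
  simp only [Done, not_forall, not_not] at h
  obtain ⟨μ, p', hs⟩ := h
  exact ⟨μ, cons_mem_traces.2 ⟨p', hs, nil_mem_traces p'⟩⟩

theorem traces_par_done_left {p q : Term A} (hp : Done p) : traces (par p q) = traces q := by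
  ext φ
  rw [mem_traces_par, done_iff_traces.1 hp]
  constructor
  · rintro ⟨φ₁, rfl, φ₂, h, hm⟩
    rwa [hm.eq_of_nil_left]
  · exact fun h => ⟨[], rfl, φ, h, Merge.nil_left φ⟩

theorem traces_par_done_right {p q : Term A} (hq : Done q) : traces (par p q) = traces p :=
  (traces_par_comm p q).trans (traces_par_done_left hq)

/-! ### Possible futures -/

theorem mem_possibleFutures {p : Term A} {φ : List (Act A)} {X : Set (List (Act A))} :
    (φ, X) ∈ possibleFutures p ↔ ∃ p', Steps p φ p' ∧ X = traces p' := Iff.rfl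

/-- The possible futures of `p` with a non-empty trace. -/
def properFutures (p : Term A) : Set (List (Act A) × Set (List (Act A))) :=
  {f | f ∈ possibleFutures p ∧ f.1 ≠ []}

/-- The future of the empty trace is redundant: its trace set is recovered from the non-empty
traces. Discarding it makes `+` act as a union, see `properFutures_add`. -/
theorem pfEquiv_iff {p q : Term A} : PFEquiv p q ↔ properFutures p = properFutures q := by
  constructor
  · intro h
    rw [PFEquiv] at h
    rw [properFutures, h, properFutures]
  · intro h
    have key : ∀ {p q : Term A}, properFutures p = properFutures q → traces p ⊆ traces q := by
      rintro p q h φ ⟨w, hw⟩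
      by_cases hφ : φ = []
      · subst hφ; exact nil_mem_traces q
      · have : (φ, traces w) ∈ properFutures p := ⟨⟨w, hw, rfl⟩, hφ⟩
        rw [h] at this
        obtain ⟨⟨v, hv, -⟩, -⟩ := this
        exact ⟨v, hv⟩
    have ht : traces p = traces q := (key h).antisymm (key h.symm)
    ext ⟨φ, X⟩
    by_cases hφ : φ = []
    · subst hφ
      simp [mem_possibleFutures, steps_nil, ht]
    · have := Set.ext_iff.1 h (φ, X)
      simpa [properFutures, hφ] using this

theorem PFEquiv.refl (p : Term A) : PFEquiv p p := rfl

theorem PFEquiv.traces_eq {p q : Term A} (h : PFEquiv p q) : traces p = traces q := by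
  have : ([], traces p) ∈ possibleFutures q := h ▸ ⟨p, Steps.nil p, rfl⟩
  obtain ⟨w, hw, e⟩ := this
  rw [steps_nil] at hw
  rw [hw] at e
  exact e

theorem PFEquiv.done_iff {p q : Term A} (h : PFEquiv p q) : Done p ↔ Done q := by
  rw [done_iff_traces, done_iff_traces, h.traces_eq]

theorem Done.pfEquiv {p q : Term A} (hp : Done p) (hq : Done q) : PFEquiv p q := by
  rw [pfEquiv_iff]
  ext ⟨φ, X⟩
  constructor
  · rintro ⟨⟨w, hw, -⟩, h⟩; exact absurd (hp.steps hw).1 h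
  · rintro ⟨⟨w, hw, -⟩, h⟩; exact absurd (hq.steps hw).1 h

theorem pfEquiv_zero_iff {p : Term A} : PFEquiv p zero ↔ Done p :=
  ⟨fun h => h.done_iff.2 done_zero, fun h => h.pfEquiv done_zero⟩

theorem properFutures_add (p q : Term A) :
    properFutures (Term.add p q) = properFutures p ∪ properFutures q := by
  ext ⟨φ, X⟩
  cases φ with
  | nil => simp [properFutures]
  | cons μ φ =>
    simp only [properFutures, Set.mem_ofPred_eq, Set.mem_union, mem_possibleFutures, steps_cons]
    constructor
    · rintro ⟨⟨w, ⟨v, hv, hw⟩, rfl⟩, h⟩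
      cases hv with
      | addL hv => exact Or.inl ⟨⟨w, ⟨v, hv, hw⟩, rfl⟩, h⟩
      | addR hv => exact Or.inr ⟨⟨w, ⟨v, hv, hw⟩, rfl⟩, h⟩
    · rintro (⟨⟨w, ⟨v, hv, hw⟩, rfl⟩, h⟩ | ⟨⟨w, ⟨v, hv, hw⟩, rfl⟩, h⟩)
      · exact ⟨⟨w, ⟨v, Step.addL hv, hw⟩, rfl⟩, h⟩
      · exact ⟨⟨w, ⟨v, Step.addR hv, hw⟩, rfl⟩, h⟩

theorem PFEquiv.add {p p' q q' : Term A} (hp : PFEquiv p p') (hq : PFEquiv q q') :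
    PFEquiv (Term.add p q) (Term.add p' q') := by
  rw [pfEquiv_iff] at *
  rw [properFutures_add, properFutures_add, hp, hq]

theorem steps_pre_cons {p w : Term A} {μ ν : Act A} {φ : List (Act A)} :
    Steps (pre μ p) (ν :: φ) w ↔ ν = μ ∧ Steps p φ w := by
  rw [steps_cons]
  constructor
  · rintro ⟨v, hv, hw⟩
    cases hv
    exact ⟨rfl, hw⟩
  · rintro ⟨rfl, hw⟩
    exact ⟨p, Step.pre _ _, hw⟩

theorem PFEquiv.pre (μ : Act A) {p q : Term A} (h : PFEquiv p q) :
    PFEquiv (pre μ p) (pre μ q) := by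
  rw [pfEquiv_iff]
  ext ⟨φ, X⟩
  cases φ with
  | nil => simp [properFutures]
  | cons ν φ =>
    have := Set.ext_iff.1 h (φ, X)
    simp only [mem_possibleFutures] at this
    simp only [properFutures, Set.mem_ofPred_eq, mem_possibleFutures, steps_pre_cons, and_assoc,
      exists_and_left, this]

theorem possibleFutures_par_subset {p p' q q' : Term A}
    (hp : possibleFutures p ⊆ possibleFutures p') (hq : possibleFutures q ⊆ possibleFutures q') :
    possibleFutures (par p q) ⊆ possibleFutures (par p' q') := by
  rintro ⟨φ, X⟩ ⟨w, hw, hX⟩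
  obtain ⟨φ₁, φ₂, v₁, v₂, hm, h₁, h₂, rfl⟩ := steps_par_iff.1 hw
  obtain ⟨w₁, hw₁, e₁⟩ := hp (show (φ₁, traces v₁) ∈ _ from ⟨v₁, h₁, rfl⟩)
  obtain ⟨w₂, hw₂, e₂⟩ := hq (show (φ₂, traces v₂) ∈ _ from ⟨v₂, h₂, rfl⟩)
  exact ⟨par w₁ w₂, steps_par_iff.2 ⟨φ₁, φ₂, w₁, w₂, hm, hw₁, hw₂, rfl⟩,
    hX.trans (traces_par_congr e₁ e₂)⟩

theorem PFEquiv.par {p p' q q' : Term A} (hp : PFEquiv p p') (hq : PFEquiv q q') :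
    PFEquiv (par p q) (par p' q') :=
  (possibleFutures_par_subset hp.subset hq.subset).antisymm
    (possibleFutures_par_subset hp.symm.subset hq.symm.subset)

theorem pfEquiv_par_comm (p q : Term A) : PFEquiv (par p q) (par q p) := by
  have key : ∀ p q : Term A, possibleFutures (par p q) ⊆ possibleFutures (par q p) := by
    rintro p q ⟨φ, X⟩ ⟨w, hw, hX⟩
    obtain ⟨φ₁, φ₂, v₁, v₂, hm, h₁, h₂, rfl⟩ := steps_par_iff.1 hw
    exact ⟨Term.par v₂ v₁, steps_par_iff.2 ⟨φ₂, φ₁, v₂, v₁, hm.symm, h₂, h₁, rfl⟩,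
      hX.trans (traces_par_comm v₁ v₂)⟩
  exact (key p q).antisymm (key q p)

theorem pfEquiv_par_done_left {p q : Term A} (hp : Done p) : PFEquiv (par p q) q := by
  ext ⟨φ, X⟩
  constructor
  · rintro ⟨w, hw, hX⟩
    obtain ⟨φ₁, φ₂, v₁, v₂, hm, h₁, h₂, rfl⟩ := steps_par_iff.1 hw
    obtain ⟨rfl, rfl⟩ := hp.steps h₁
    obtain rfl := hm.eq_of_nil_left
    exact ⟨v₂, h₂, hX.trans (traces_par_done_left hp)⟩
  · rintro ⟨w, hw, hX⟩
    exact ⟨par p w, steps_par_iff.2 ⟨[], φ, p, w, Merge.nil_left φ, Steps.nil p, hw, rfl⟩,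
      hX.trans (traces_par_done_left hp).symm⟩

theorem pfEquiv_par_done_right {p q : Term A} (hq : Done q) : PFEquiv (par p q) p :=
  (pfEquiv_par_comm p q).trans (pfEquiv_par_done_left hq)

/-! ### The processes `b ⋯ b a` and `p_N` -/

theorem mem_traces_prePow {a b : A} {n : ℕ} {φ : List (Act A)} :
    φ ∈ traces (prePow (Act.name b) n (act a)) ↔ φ <+: word a b n := by
  induction n generalizing φ with
  | zero =>
    cases φ with
    | nil => simpa using nil_mem_traces _
    | cons μ φ =>
      rw [cons_mem_traces, word_zero, List.cons_prefix_cons, List.prefix_nil]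
      constructor
      · rintro ⟨p', hs, h⟩
        cases hs
        rw [done_iff_traces.1 done_zero] at h
        exact ⟨rfl, h⟩
      · rintro ⟨rfl, rfl⟩
        exact ⟨zero, Step.pre _ _, nil_mem_traces _⟩
  | succ n ih =>
    cases φ with
    | nil => simpa using nil_mem_traces _
    | cons μ φ =>
      rw [cons_mem_traces, word_succ, List.cons_prefix_cons, ← ih]
      constructor
      · rintro ⟨p', hs, h⟩
        cases hs
        exact ⟨rfl, h⟩
      · rintro ⟨rfl, h⟩
        exact ⟨_, Step.pre _ _, h⟩

theorem mem_traces_act {a : A} {φ : List (Act A)} :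
    φ ∈ traces (act a) ↔ φ <+: [Act.name a] :=
  mem_traces_prePow (a := a) (b := a) (n := 0)

theorem word_mem_traces_prePow (a b : A) (n : ℕ) :
    word a b n ∈ traces (prePow (Act.name b) n (act a)) :=
  mem_traces_prePow.2 (List.prefix_refl _)

theorem step_sum_iff {l : List (Term A)} {μ : Act A} {w : Term A} :
    Step (Term.sum l) μ w ↔ ∃ t ∈ l, Step t μ w := by
  induction l with
  | nil => simpa [Term.sum] using done_zero μ w
  | cons t l ih =>
    cases l with
    | nil => simp [Term.sum]
    | cons u l =>
      rw [Term.sum, List.exists_mem_cons_iff, ← ih]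
      constructor
      · intro h
        cases h with
        | addL h => exact Or.inl h
        | addR h => exact Or.inr h
      · rintro (h | h)
        · exact Step.addL h
        · exact Step.addR h

theorem step_pN_iff {a b : A} {N : ℕ} {μ : Act A} {w : Term A} :
    Step (pN a b N) μ w ↔
      μ = Act.name b ∧ ∃ i < N, w = prePow (Act.name b) i (act a) := by
  rw [pN, step_sum_iff]
  constructor
  · rintro ⟨t, ht, hs⟩
    rw [List.mem_map] at ht
    obtain ⟨i, hi, rfl⟩ := ht
    cases hs
    exact ⟨rfl, i, List.mem_range.1 hi, rfl⟩
  · rintro ⟨rfl, i, hi, rfl⟩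
    exact ⟨_, List.mem_map.2 ⟨i, List.mem_range.2 hi, rfl⟩, Step.pre _ _⟩

theorem cons_mem_traces_pN {a b : A} {N : ℕ} {μ : Act A} {φ : List (Act A)} :
    μ :: φ ∈ traces (pN a b N) ↔ μ = Act.name b ∧ ∃ i < N, φ <+: word a b i := by
  rw [cons_mem_traces]
  constructor
  · rintro ⟨p', hs, h⟩
    obtain ⟨rfl, i, hi, rfl⟩ := step_pN_iff.1 hs
    exact ⟨rfl, i, hi, mem_traces_prePow.1 h⟩
  · rintro ⟨rfl, i, hi, h⟩
    exact ⟨_, step_pN_iff.2 ⟨rfl, i, hi, rfl⟩, mem_traces_prePow.2 h⟩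

/-- After a first b only prefixes of a single word bᵏa remain, so a completed bⁱa leaves no room for
a further action. -/
theorem word_append_singleton_notMem {a b : A} (hab : a ≠ b) {p : Term A}
    (h : ∀ μ p', Step p μ p' →
      μ = Act.name b ∧ ∃ k, traces p' = traces (prePow (Act.name b) k (act a)))
    (i : ℕ) (μ : Act A) : word a b i ++ [μ] ∉ traces p := by
  intro hm
  cases i with
  | zero =>
    obtain ⟨p', hs, -⟩ := cons_mem_traces.1 hm
    have := (h _ _ hs).1
    rw [Act.name.injEq] at this
    exact hab this
  | succ i =>
    rw [word_succ, List.cons_append] at hm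
    obtain ⟨p', hs, hm⟩ := cons_mem_traces.1 hm
    obtain ⟨-, k, hk⟩ := h _ _ hs
    rw [hk, mem_traces_prePow] at hm
    have := (eq_of_word_append_prefix hab hm).2
    simp at this

theorem word_append_singleton_notMem_pN {a b : A} (hab : a ≠ b) (N i : ℕ) (μ : Act A) :
    word a b i ++ [μ] ∉ traces (pN a b N) := by
  refine word_append_singleton_notMem hab (fun μ p' hs => ?_) i μ
  obtain ⟨rfl, k, -, rfl⟩ := step_pN_iff.1 hs
  exact ⟨rfl, k, rfl⟩

/-- If neither component has terminated, the component that completes a word `b ⋯ b a` can be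
followed by an action of the other one. -/
theorem exists_word_append_mem_traces_par {a b : A} {p q : Term A} {n : ℕ} (hp : ¬ Done p)
    (hq : ¬ Done q) (h : word a b n ∈ traces (par p q)) :
    ∃ i μ, word a b i ++ [μ] ∈ traces (par p q) := by
  obtain ⟨φ₁, h₁, φ₂, h₂, hm⟩ := mem_traces_par.1 h
  obtain ⟨i, j, -, ⟨rfl, rfl⟩ | ⟨rfl, rfl⟩⟩ := hm.of_word
  · obtain ⟨μ, hμ⟩ := exists_singleton_mem_traces hq
    exact ⟨i, μ, mem_traces_par.2 ⟨_, h₁, _, hμ, Merge.append _ _⟩⟩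
  · obtain ⟨μ, hμ⟩ := exists_singleton_mem_traces hp
    exact ⟨j, μ, mem_traces_par.2 ⟨_, hμ, _, h₂, (Merge.append _ _).symm⟩⟩

-- The second a can only be performed once the right component has gone through all its n actions b.
-- Two occurrences of a therefore fix the number of b's.
open Classical in
theorem count_of_mem_traces_par {a b : A} (hab : a ≠ b) {n : ℕ} {φ : List (Act A)}
    (h : φ ∈ traces (par (act a) (prePow (Act.name b) n (act a)))) :
    φ.count (Act.name b) ≤ n ∧ φ.count (Act.name a) ≤ 2 ∧
      (φ.count (Act.name a) = 2 → φ.count (Act.name b) = n) ∧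
      ∀ μ ∈ φ, μ = Act.name a ∨ μ = Act.name b := by
  obtain ⟨φ₁, h₁, φ₂, h₂, hm⟩ := mem_traces_par.1 h
  rw [mem_traces_act] at h₁
  rw [mem_traces_prePow] at h₂
  have hp := hm.perm (fun c hc => by simpa using h₁.subset hc)
    (fun c hc => coname_notMem_word a b c n (h₂.subset hc))
  have hne : Act.name b ≠ Act.name a := by simpa using hab.symm
  have hφ₁ : φ₁ = [] ∨ φ₁ = [Act.name a] := by
    cases φ₁ with
    | nil => exact Or.inl rfl
    | cons μ φ₁ => right; simpa [List.cons_prefix_cons] using h₁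
  refine ⟨?_, ?_, ?_, fun μ hμ => ?_⟩
  · rw [hp.count_eq]
    rcases hφ₁ with rfl | rfl <;>
      rcases prefix_word_iff.1 h₂ with ⟨k, hk, rfl⟩ | rfl <;>
      simp [word, hne.symm, *]
  · rw [hp.count_eq]
    rcases hφ₁ with rfl | rfl <;>
      rcases prefix_word_iff.1 h₂ with ⟨k, hk, rfl⟩ | rfl <;>
      simp [word, List.count_replicate, *]
  · rw [hp.count_eq, hp.count_eq]
    rcases hφ₁ with rfl | rfl <;>
      rcases prefix_word_iff.1 h₂ with ⟨k, hk, rfl⟩ | rfl <;>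
      simp [word, List.count_replicate, hne.symm, *]
  · rcases List.mem_append.1 (hp.subset hμ) with hμ | hμ
    · exact Or.inl (by simpa using h₁.subset hμ)
    · have := h₂.subset hμ
      simp only [word, List.mem_append, List.mem_replicate, List.mem_singleton] at this
      tauto

/-! ### The factors of `a ‖ p_N` -/

/-- The process `a ‖ p_N`. -/
abbrev target (a b : A) (N : ℕ) : Term A := par (act a) (pN a b N)

/-- The process `p` can terminate by performing `a`. -/
def CanFinish (a : A) (p : Term A) : Prop := ∃ p', Step p (Act.name a) p' ∧ Done p'

theorem step_of_properFutures_subset {a b : A} {N : ℕ} {p w : Term A} {μ : Act A}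
    (h : properFutures p ⊆ properFutures (target a b N)) (hs : Step p μ w) :
    (μ = Act.name a ∧ traces w = traces (pN a b N)) ∨
      (μ = Act.name b ∧ ∃ i < N,
        traces w = traces (par (act a) (prePow (Act.name b) i (act a)))) := by
  have : ([μ], traces w) ∈ properFutures p := ⟨⟨w, steps_singleton.2 hs, rfl⟩, by simp⟩
  obtain ⟨⟨v, hv, e⟩, -⟩ := h this
  rw [steps_singleton] at hv
  cases hv with
  | parL hv =>
    cases hv
    exact Or.inl ⟨rfl, e.trans (traces_par_done_left done_zero)⟩
  | parR hv =>
    obtain ⟨rfl, i, hi, rfl⟩ := step_pN_iff.1 hv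
    exact Or.inr ⟨rfl, i, hi, e⟩
  | syncL _ hv => simpa using (step_pN_iff.1 hv).1
  | syncR hv _ => cases hv

theorem word_mem_traces_pN (a b : A) {N i : ℕ} (hi : i < N) :
    word a b (i + 1) ∈ traces (pN a b N) :=
  cons_mem_traces_pN.2 ⟨rfl, i, hi, List.prefix_refl _⟩

/-- When r terminates by a, what remains is s alone, and every a-derivative of a ‖ p_N has the
traces of p_N. -/
theorem traces_right_factor {a b : A} {N : ℕ} (hab : a ≠ b) {r s : Term A}
    (h : properFutures (par r s) ⊆ properFutures (target a b N)) (hr : CanFinish a r) :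
    traces s = traces (pN a b N) := by
  obtain ⟨r', hs, hd⟩ := hr
  rcases step_of_properFutures_subset h (Step.parL hs) with ⟨-, e⟩ | ⟨e, -⟩
  · rwa [traces_par_done_left hd] at e
  · rw [Act.name.injEq] at e
    exact absurd e hab

theorem CanFinish.singleton_mem_traces {a : A} {p : Term A} (h : CanFinish a p) :
    [Act.name a] ∈ traces p := by
  obtain ⟨p', hs, -⟩ := h
  exact cons_mem_traces.2 ⟨p', hs, nil_mem_traces p'⟩

theorem step_right_factor {a b : A} {N : ℕ} (hab : a ≠ b) {r s w : Term A} {μ : Act A}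
    (h : properFutures (par r s) ⊆ properFutures (target a b N)) (hr : CanFinish a r)
    (hs : Step s μ w) :
    μ = Act.name b ∧ ∃ i < N,
      traces (par r w) = traces (par (act a) (prePow (Act.name b) i (act a))) := by
  have hμ : [μ] ∈ traces s := cons_mem_traces.2 ⟨w, hs, nil_mem_traces w⟩
  rw [traces_right_factor hab h hr, cons_mem_traces_pN] at hμ
  obtain ⟨rfl, -⟩ := hμ
  rcases step_of_properFutures_subset h (Step.parR (t := r) hs) with ⟨e, -⟩ | ⟨-, e⟩
  · rw [Act.name.injEq] at e
    exact absurd e.symm hab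
  · exact ⟨rfl, e⟩

-- Letting r perform its a after bᵐa yields a trace with two a's, and such a trace has exactly i
-- occurrences of b.
open Classical in
theorem eq_of_word_mem_traces {a b : A} (hab : a ≠ b) {r w : Term A} {i m : ℕ}
    (hr : CanFinish a r)
    (h : traces (par r w) = traces (par (act a) (prePow (Act.name b) i (act a))))
    (hm : word a b m ∈ traces w) : m = i := by
  have hw : word a b m ++ [Act.name a] ∈ traces (par r w) :=
    mem_traces_par.2 ⟨_, hr.singleton_mem_traces, _, hm, (Merge.append _ _).symm⟩
  rw [h] at hw
  have hne : Act.name b ≠ Act.name a := by simpa using hab.symm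
  have := (count_of_mem_traces_par hab hw).2.2.1
    (by simp [word, List.count_replicate, hne])
  simpa [word, List.count_cons, hne.symm] using this

open Classical in
theorem traces_left_factor {a b : A} {N : ℕ} (hab : a ≠ b) (hN : 1 ≤ N) {r s : Term A}
    (h : properFutures (par r s) ⊆ properFutures (target a b N)) (hr : CanFinish a r) :
    traces r = traces (act a) := by
  have hs := traces_right_factor hab h hr
  -- Any summand of p_N would do here; `hN` provides one.
  have hw : word a b (N - 1 + 1) ∈ traces s := hs ▸ word_mem_traces_pN a b (by omega)
  obtain ⟨w, hw, hm⟩ := cons_mem_traces.1 hw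
  obtain ⟨-, i, hi, e⟩ := step_right_factor hab h hr hw
  have hNi := eq_of_word_mem_traces hab hr e hm
  have hne : Act.name b ≠ Act.name a := by simpa using hab.symm
  ext φ
  rw [mem_traces_act]
  constructor
  · intro hφ
    -- Once w has performed its whole word, the bounds on the numbers of a's and b's leave for r no
    -- b and at most one a.
    have hmem : word a b (N - 1) ++ φ ∈ traces (par r w) :=
      mem_traces_par.2 ⟨_, hφ, _, hm, (Merge.append _ _).symm⟩
    rw [e, hNi] at hmem
    obtain ⟨h₁, h₂, -, h₃⟩ := count_of_mem_traces_par hab hmem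
    simp only [word, List.append_assoc, List.count_append, List.count_replicate_self,
      List.count_singleton, List.count_replicate] at h₁ h₂
    simp only [beq_iff_eq, hne.symm, hne, if_false, if_true] at h₁ h₂
    have hb : Act.name b ∉ φ := List.count_eq_zero.1 (by omega)
    have ha : ∀ μ ∈ φ, μ = Act.name a := fun μ hμ =>
      (h₃ μ (by simp [hμ])).resolve_right (fun e => hb (e ▸ hμ))
    rw [List.eq_replicate_of_mem ha] at h₂ ⊢
    rw [List.count_replicate_self] at h₂
    have : φ.length = 0 ∨ φ.length = 1 := by omega
    rcases this with e | e <;> rw [e] <;> simp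
  · exact fun hφ => mem_traces_of_prefix hφ hr.singleton_mem_traces

open Classical in
theorem traces_step_right_factor {a b : A} {N : ℕ} (hab : a ≠ b) (hN : 1 ≤ N) {r s w : Term A}
    {μ : Act A} (h : properFutures (par r s) ⊆ properFutures (target a b N))
    (hr : CanFinish a r) (hs : Step s μ w) :
    μ = Act.name b ∧ ∃ i < N, traces w = traces (prePow (Act.name b) i (act a)) := by
  obtain ⟨rfl, i, hi, e⟩ := step_right_factor hab h hr hs
  refine ⟨rfl, i, hi, ?_⟩
  have hne : Act.name b ≠ Act.name a := by simpa using hab.symm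
  have hsub : ∀ φ ∈ traces w, ∃ m, φ <+: word a b m := fun φ hφ => by
    have : Act.name b :: φ ∈ traces s := cons_mem_traces.2 ⟨w, hs, hφ⟩
    rw [traces_right_factor hab h hr, cons_mem_traces_pN] at this
    obtain ⟨-, m, -, hm⟩ := this
    exact ⟨m, hm⟩
  have hword : word a b i ∈ traces w := by
    -- In the trace abⁱa the component r supplies at most one a. The other a comes from w, which
    -- must then have performed a complete word.
    have hmem : Act.name a :: word a b i ∈ traces (par r w) := by
      rw [e]
      exact mem_traces_par.2 ⟨[Act.name a], mem_traces_act.2 (List.prefix_refl _), _,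
        word_mem_traces_prePow a b i, Merge.append _ _⟩
    obtain ⟨φ₁, h₁, φ₂, h₂, hm⟩ := mem_traces_par.1 hmem
    rw [traces_left_factor hab hN h hr, mem_traces_act] at h₁
    obtain ⟨m, hφ₂⟩ := hsub φ₂ h₂
    have hp := hm.perm (fun c hc => by simpa using h₁.subset hc)
      (fun c hc => coname_notMem_word a b c m (hφ₂.subset hc))
    have hc := hp.count_eq (Act.name a)
    have hc₁ := h₁.sublist.count_le (Act.name a)
    rcases prefix_word_iff.1 hφ₂ with ⟨k, -, rfl⟩ | rfl
    · simp [word, List.count_replicate, hne] at hc hc₁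
      omega
    · rwa [← eq_of_word_mem_traces hab hr e h₂]
  ext φ
  rw [mem_traces_prePow]
  constructor
  · intro hφ
    obtain ⟨m, hm⟩ := hsub φ hφ
    rcases prefix_word_iff.1 hm with ⟨k, -, rfl⟩ | rfl
    · have hmem := mem_traces_par.2 ⟨_, nil_mem_traces r, _, hφ, Merge.nil_left _⟩
      rw [e] at hmem
      have := (count_of_mem_traces_par hab hmem).1
      rw [List.count_replicate_self] at this
      exact prefix_word_iff.2 (Or.inl ⟨k, this, rfl⟩)
    · rw [eq_of_word_mem_traces hab hr e hφ]
  · exact fun hφ => mem_traces_of_prefix hφ hword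

/-- A process with the traces of `b ⋯ b a` has all its possible futures. -/
theorem possibleFutures_prePow_subset {a b : A} {n : ℕ} {w : Term A}
    (h : traces w = traces (prePow (Act.name b) n (act a))) :
    possibleFutures (prePow (Act.name b) n (act a)) ⊆ possibleFutures w := by
  induction n generalizing w with
  | zero =>
    rintro ⟨φ, X⟩ ⟨v, hv, hX⟩
    cases φ with
    | nil =>
      rw [steps_nil] at hv
      subst hv
      exact ⟨w, Steps.nil w, hX.trans h.symm⟩
    | cons μ φ =>
      obtain ⟨rfl, hv'⟩ := steps_pre_cons.1 hv
      obtain ⟨rfl, rfl⟩ := done_zero.steps hv'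
      have hmem : [Act.name a] ∈ traces w := h ▸ word_mem_traces_prePow a b 0
      obtain ⟨w', hw', -⟩ := cons_mem_traces.1 hmem
      refine ⟨w', steps_singleton.2 hw', hX.trans ?_⟩
      rw [done_iff_traces.1 done_zero]
      ext ψ
      constructor
      · rintro rfl; exact nil_mem_traces w'
      · intro hψ
        have : Act.name a :: ψ ∈ traces w := cons_mem_traces.2 ⟨w', hw', hψ⟩
        rw [h, mem_traces_prePow, word_zero, List.cons_prefix_cons] at this
        simpa using this.2
  | succ n ih =>
    rintro ⟨φ, X⟩ ⟨v, hv, hX⟩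
    cases φ with
    | nil =>
      rw [steps_nil] at hv
      subst hv
      exact ⟨w, Steps.nil w, hX.trans h.symm⟩
    | cons μ φ =>
      obtain ⟨rfl, hv'⟩ := steps_pre_cons.1 hv
      have hmem : Act.name b :: word a b n ∈ traces w := h ▸ word_mem_traces_prePow a b (n + 1)
      -- The derivative has to be one that can still perform the whole word: w may have other
      -- b-derivatives with fewer traces. For this reason only an inclusion of futures is obtained.
      obtain ⟨w', hw', hw⟩ := cons_mem_traces.1 hmem
      have ht : traces w' = traces (prePow (Act.name b) n (act a)) := by
        ext ψ
        rw [mem_traces_prePow]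
        constructor
        · intro hψ
          have : Act.name b :: ψ ∈ traces w := cons_mem_traces.2 ⟨w', hw', hψ⟩
          rw [h, mem_traces_prePow, word_succ, List.cons_prefix_cons] at this
          exact this.2
        · exact fun hψ => mem_traces_of_prefix hψ hw
      obtain ⟨w'', hw'', e⟩ := ih ht (show (φ, traces v) ∈ _ from ⟨v, hv', rfl⟩)
      exact ⟨w'', Steps.cons hw' hw'', hX.trans e⟩

theorem exists_step_of_traces_eq_pN {a b : A} {N : ℕ} (hab : a ≠ b) {s : Term A}
    (h : traces s = traces (pN a b N))
    (hstep : ∀ μ w, Step s μ w →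
      μ = Act.name b ∧ ∃ i < N, traces w = traces (prePow (Act.name b) i (act a)))
    {i : ℕ} (hi : i < N) :
    ∃ w, Step s (Act.name b) w ∧ traces w = traces (prePow (Act.name b) i (act a)) := by
  have hmem : Act.name b :: word a b i ∈ traces s := h ▸ word_mem_traces_pN a b hi
  obtain ⟨w, hw, hm⟩ := cons_mem_traces.1 hmem
  obtain ⟨-, k, -, e⟩ := hstep _ _ hw
  rw [e, mem_traces_prePow] at hm
  obtain ⟨rfl, -⟩ := eq_of_word_append_prefix hab (ψ := []) (by simpa using hm)
  exact ⟨w, hw, e⟩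

/-- Inclusion is enough because r has the traces of a, and s has for each i < N a b-derivative with
the traces of bⁱa. Trace sets of linear words already force the futures of these words. -/
theorem pfEquiv_target_of_canFinish {a b : A} {N : ℕ} (hab : a ≠ b) (hN : 1 ≤ N) {r s : Term A}
    (h : properFutures (par r s) ⊆ properFutures (target a b N)) (hr : CanFinish a r) :
    PFEquiv (par r s) (target a b N) := by
  rw [pfEquiv_iff]
  refine h.antisymm fun f hf => ⟨possibleFutures_par_subset ?_ ?_ hf.1, hf.2⟩
  · exact possibleFutures_prePow_subset (b := b) (n := 0) (traces_left_factor hab hN h hr)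
  · have hs := traces_right_factor hab h hr
    rintro ⟨φ, X⟩ ⟨v, hv, hX⟩
    cases φ with
    | nil =>
      rw [steps_nil] at hv
      subst hv
      exact ⟨s, Steps.nil s, hX.trans hs.symm⟩
    | cons μ φ =>
      obtain ⟨v', hv', hv⟩ := steps_cons.1 hv
      obtain ⟨rfl, i, hi, rfl⟩ := step_pN_iff.1 hv'
      obtain ⟨w, hw, e⟩ := exists_step_of_traces_eq_pN hab hs
        (fun μ w => traces_step_right_factor hab hN h hr) hi
      obtain ⟨w', hw', e'⟩ := possibleFutures_prePow_subset e
        (show (φ, traces v) ∈ _ from ⟨v, hv, rfl⟩)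
      exact ⟨w', Steps.cons hw hw', hX.trans e'⟩

/-- The a-move of a ‖ p_N to a process with the traces of p_N is matched by one component. If that
component were still active afterwards, the other active one could perform an action after some
completed bⁱa, which p_N forbids. -/
theorem canFinish_or_of_pfEquiv_target {a b : A} {N : ℕ} (hab : a ≠ b) (hN : 1 ≤ N)
    {r s : Term A} (h : PFEquiv (par r s) (target a b N)) (hr : ¬ Done r) (hs : ¬ Done s) :
    CanFinish a r ∨ CanFinish a s := by
  have key : ∀ p q : Term A, traces (par p q) = traces (pN a b N) → ¬ Done p → Done q := by
    intro p q e hp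
    by_contra hq
    have hm : word a b 1 ∈ traces (par p q) := e ▸ word_mem_traces_pN a b (i := 0) (by omega)
    obtain ⟨i, μ, hmem⟩ := exists_word_append_mem_traces_par hp hq hm
    rw [e] at hmem
    exact word_append_singleton_notMem_pN hab N i μ hmem
  have hf : ([Act.name a], traces (pN a b N)) ∈ possibleFutures (par r s) := by
    rw [h]
    exact ⟨par zero (pN a b N), steps_singleton.2 (Step.parL (Step.pre _ _)),
      (traces_par_done_left done_zero).symm⟩
  obtain ⟨w, hw, e⟩ := hf
  rw [steps_singleton] at hw
  generalize hμ : Act.name a = μ at hw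
  cases hw with
  | parL hw =>
    subst hμ
    exact Or.inl ⟨_, hw, key s _ ((traces_par_comm _ _).trans e.symm) hs⟩
  | parR hw =>
    subst hμ
    exact Or.inr ⟨_, hw, key r _ e.symm hr⟩
  | syncL => cases hμ
  | syncR => cases hμ

/-! ### Completed traces -/

/-- The process `p` can terminate by performing `φ`. -/
def Completes (φ : List (Act A)) (p : Term A) : Prop := ∃ w, Steps p φ w ∧ Done w

/-- Termination is visible in a possible future: it is the trace set containing only the empty
trace. -/
theorem PFEquiv.completes {p q : Term A} (h : PFEquiv p q) {φ : List (Act A)}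
    (hp : Completes φ p) : Completes φ q := by
  obtain ⟨w, hw, hd⟩ := hp
  have : (φ, traces w) ∈ possibleFutures q := h ▸ ⟨w, hw, rfl⟩
  obtain ⟨v, hv, e⟩ := this
  exact ⟨v, hv, done_iff_traces.2 (e.symm.trans (done_iff_traces.1 hd))⟩

theorem completes_nil {p : Term A} : Completes [] p ↔ Done p := by
  simp [Completes, steps_nil]

theorem completes_singleton {a : A} {p : Term A} : Completes [Act.name a] p ↔ CanFinish a p := by
  simp [Completes, steps_singleton, CanFinish]

theorem completes_pre_cons {μ ν : Act A} {φ : List (Act A)} {p : Term A} :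
    Completes (ν :: φ) (pre μ p) ↔ ν = μ ∧ Completes φ p := by
  simp [Completes, steps_pre_cons, and_assoc]

theorem completes_add_cons {μ : Act A} {φ : List (Act A)} {p q : Term A} :
    Completes (μ :: φ) (Term.add p q) ↔ Completes (μ :: φ) p ∨ Completes (μ :: φ) q := by
  simp only [Completes, steps_cons]
  constructor
  · rintro ⟨w, ⟨v, hv, hw⟩, hd⟩
    cases hv with
    | addL hv => exact Or.inl ⟨w, ⟨v, hv, hw⟩, hd⟩
    | addR hv => exact Or.inr ⟨w, ⟨v, hv, hw⟩, hd⟩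
  · rintro (⟨w, ⟨v, hv, hw⟩, hd⟩ | ⟨w, ⟨v, hv, hw⟩, hd⟩)
    · exact ⟨w, ⟨v, Step.addL hv, hw⟩, hd⟩
    · exact ⟨w, ⟨v, Step.addR hv, hw⟩, hd⟩

theorem completes_par {φ : List (Act A)} {p q : Term A} :
    Completes φ (par p q) ↔ ∃ φ₁ φ₂, Merge φ₁ φ₂ φ ∧ Completes φ₁ p ∧ Completes φ₂ q := by
  constructor
  · rintro ⟨w, hw, hd⟩
    obtain ⟨φ₁, φ₂, v₁, v₂, hm, h₁, h₂, rfl⟩ := steps_par_iff.1 hw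
    rw [done_par] at hd
    exact ⟨φ₁, φ₂, hm, ⟨v₁, h₁, hd.1⟩, v₂, h₂, hd.2⟩
  · rintro ⟨φ₁, φ₂, hm, ⟨v₁, h₁, d₁⟩, v₂, h₂, d₂⟩
    exact ⟨par v₁ v₂, steps_par_iff.2 ⟨φ₁, φ₂, v₁, v₂, hm, h₁, h₂, rfl⟩, done_par.2 ⟨d₁, d₂⟩⟩

theorem Step.size_lt {p p' : Term A} {μ : Act A} (h : Step p μ p') : p'.size < p.size := by
  induction h <;> simp only [Term.size] <;> omega

theorem Completes.length_le {φ : List (Act A)} {p : Term A} (h : Completes φ p) :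
    φ.length ≤ p.size := by
  obtain ⟨w, hw, -⟩ := h
  induction hw with
  | nil => exact Nat.zero_le _
  | cons hs _ ih =>
    have := hs.size_lt
    rw [List.length_cons]
    omega

theorem completes_prePow_iff {b : A} {n : ℕ} {φ : List (Act A)} :
    Completes φ (prePow (Act.name b) n zero) ↔ φ = List.replicate n (Act.name b) := by
  induction n generalizing φ with
  | zero =>
    constructor
    · rintro ⟨w, hw, -⟩; exact (done_zero.steps hw).1
    · rintro rfl; exact completes_nil.2 done_zero
  | succ n ih =>
    cases φ with
    | nil => simpa [completes_nil, prePow] using not_done_pre _ _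
    | cons μ φ =>
      rw [prePow, completes_pre_cons, ih, List.replicate_succ, List.cons.injEq]

/-! ### Summands of open terms under a substitution -/

/-- `Reach σ t v`: the term `v` is a summand of `t`, up to parallel components of `t` that `σ`
instantiates to terminated processes. -/
inductive Reach (σ : ℕ → Term A) : Term A → Term A → Prop where
  | refl (t : Term A) : Reach σ t t
  | addL {t u v : Term A} : Reach σ t v → Reach σ (Term.add t u) v
  | addR {t u v : Term A} : Reach σ u v → Reach σ (Term.add t u) v
  | parL {t u v : Term A} : Done (u.subst σ) → Reach σ t v → Reach σ (par t u) v
  | parR {t u v : Term A} : Done (t.subst σ) → Reach σ u v → Reach σ (par t u) v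

theorem Reach.size_le {σ : ℕ → Term A} {t v : Term A} (h : Reach σ t v) : v.size ≤ t.size := by
  induction h with
  | refl => exact le_rfl
  | _ => simp only [Term.size]; omega

theorem Reach.properFutures_subset {σ : ℕ → Term A} {t v : Term A} (h : Reach σ t v) :
    properFutures (v.subst σ) ⊆ properFutures (t.subst σ) := by
  induction h with
  | refl => exact subset_rfl
  | addL _ ih =>
    rw [Term.subst, properFutures_add]
    exact ih.trans Set.subset_union_left
  | addR _ ih =>
    rw [Term.subst, properFutures_add]
    exact ih.trans Set.subset_union_right
  | parL hd _ ih =>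
    rw [Term.subst, pfEquiv_iff.1 (pfEquiv_par_done_right hd)]
    exact ih
  | parR hd _ ih =>
    rw [Term.subst, pfEquiv_iff.1 (pfEquiv_par_done_left hd)]
    exact ih

/-- The substitution that adds the summand `bⁿ` to the value of `σ` at `x`. -/
def extend (σ : ℕ → Term A) (x : ℕ) (b : A) (n : ℕ) : ℕ → Term A :=
  Function.update σ x (Term.add (σ x) (prePow (Act.name b) n zero))

theorem closed_extend {σ : ℕ → Term A} (hσ : ∀ y, (σ y).Closed) (x : ℕ) (b : A) (n : ℕ) (y : ℕ) :
    (extend σ x b n y).Closed := by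
  by_cases hy : y = x
  · subst hy
    rw [extend, Function.update_self]
    refine ⟨hσ y, ?_⟩
    induction n with
    | zero => trivial
    | succ n ih => exact ih
  · rw [extend, Function.update_of_ne hy]
    exact hσ y

section Extend

variable {σ : ℕ → Term A} {x : ℕ} {b : A} {n : ℕ}

theorem extend_self : extend σ x b n x = Term.add (σ x) (prePow (Act.name b) n zero) := by
  rw [extend, Function.update_self]

theorem extend_of_ne {y : ℕ} (hy : y ≠ x) : extend σ x b n y = σ y := by
  rw [extend, Function.update_of_ne hy]

/-- As σ(x) is active already, the new summand does not change which instances are terminated. So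
`Reach σ` remains meaningful for the extended substitution. -/
theorem done_subst_extend (hx : ¬ Done (σ x)) {t : Term A} :
    Done (t.subst (extend σ x b n)) ↔ Done (t.subst σ) := by
  induction t with
  | zero => exact Iff.rfl
  | var y =>
    by_cases hy : y = x
    · subst hy
      simp [Term.subst, extend_self, done_add, hx]
    · rw [Term.subst, Term.subst, extend_of_ne hy]
  | pre μ t => exact iff_of_false (not_done_pre _ _) (not_done_pre _ _)
  | add t u iht ihu => rw [Term.subst, Term.subst, done_add, done_add, iht, ihu]
  | par t u iht ihu => rw [Term.subst, Term.subst, done_par, done_par, iht, ihu]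

/-- The trace has to be non-empty, since a terminated summand does not make a sum terminated. -/
theorem Reach.completes (hx : ¬ Done (σ x)) {t v : Term A} (h : Reach σ t v)
    {μ : Act A} {φ : List (Act A)} (hv : Completes (μ :: φ) (v.subst (extend σ x b n))) :
    Completes (μ :: φ) (t.subst (extend σ x b n)) := by
  induction h with
  | refl => exact hv
  | addL _ ih => exact completes_add_cons.2 (Or.inl (ih hv))
  | addR _ ih => exact completes_add_cons.2 (Or.inr (ih hv))
  | parL hd _ ih =>
    exact PFEquiv.completes (pfEquiv_par_done_right ((done_subst_extend hx).2 hd)).symm (ih hv)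
  | parR hd _ ih =>
    exact PFEquiv.completes (pfEquiv_par_done_left ((done_subst_extend hx).2 hd)).symm (ih hv)

theorem Reach.completes_replicate (hx : ¬ Done (σ x)) {t : Term A} (h : Reach σ t (var x)) :
    Completes (List.replicate (n + 1) (Act.name b)) (t.subst (extend σ x b (n + 1))) := by
  refine h.completes hx ?_
  rw [Term.subst, extend_self, completes_add_cons]
  exact Or.inr (completes_prePow_iff.2 rfl)

theorem canFinish_subst_extend {a : A} (hx : ¬ Done (σ x)) (hab : a ≠ b) {t : Term A} :
    CanFinish a (t.subst (extend σ x b n)) ↔ CanFinish a (t.subst σ) := by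
  rw [← completes_singleton, ← completes_singleton]
  induction t with
  | zero => exact Iff.rfl
  | var y =>
    by_cases hy : y = x
    · subst hy
      rw [Term.subst, Term.subst, extend_self, completes_add_cons, completes_prePow_iff,
        or_iff_left]
      intro e
      have := List.eq_of_mem_replicate (e ▸ List.mem_singleton_self (Act.name a))
      rw [Act.name.injEq] at this
      exact hab this
    · rw [Term.subst, Term.subst, extend_of_ne hy]
  | pre μ t =>
    rw [Term.subst, Term.subst, completes_pre_cons, completes_pre_cons, completes_nil,
      completes_nil, done_subst_extend hx]
  | add t u iht ihu =>
    rw [Term.subst, Term.subst, completes_add_cons, completes_add_cons, iht, ihu]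
  | par t u iht ihu =>
    have key : ∀ p q : Term A, Completes [Act.name a] (par p q) ↔
        (Completes [Act.name a] p ∧ Done q) ∨ (Done p ∧ Completes [Act.name a] q) := by
      intro p q
      rw [completes_par]
      constructor
      · rintro ⟨φ₁, φ₂, hm, h₁, h₂⟩
        obtain ⟨i, j, hij, ⟨rfl, rfl⟩ | ⟨rfl, rfl⟩⟩ := Merge.of_word (b := b) (n := 0) hm
        · obtain ⟨rfl, rfl⟩ : i = 0 ∧ j = 0 := by omega
          exact Or.inl ⟨h₁, completes_nil.1 h₂⟩
        · obtain ⟨rfl, rfl⟩ : i = 0 ∧ j = 0 := by omega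
          exact Or.inr ⟨completes_nil.1 h₁, h₂⟩
      · rintro (⟨h₁, h₂⟩ | ⟨h₁, h₂⟩)
        · exact ⟨_, _, Merge.append _ _, h₁, completes_nil.2 h₂⟩
        · exact ⟨_, _, Merge.nil_left _, completes_nil.2 h₁, h₂⟩
    rw [Term.subst, Term.subst, key, key, iht, ihu, done_subst_extend hx, done_subst_extend hx]

/-- A completed trace cannot stop halfway through an added bⁿ. Either no copy is used, and the size
of σ(t) bounds the length, or a whole copy is used. -/
theorem le_size_or_le_of_completes_replicate {t : Term A} {k : ℕ}
    (h : Completes (List.replicate k (Act.name b)) (t.subst (extend σ x b n))) :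
    k ≤ (t.subst σ).size ∨ n ≤ k := by
  induction t generalizing k with
  | zero => exact Or.inl (by simpa [Term.subst] using h.length_le)
  | var y =>
    by_cases hy : y = x
    · subst hy
      cases k with
      | zero => exact Or.inl (Nat.zero_le _)
      | succ k =>
        rw [List.replicate_succ, Term.subst, extend_self, completes_add_cons,
          completes_prePow_iff, ← List.replicate_succ] at h
        rcases h with h | h
        · exact Or.inl (by simpa [Term.subst] using h.length_le)
        · exact Or.inr (by simpa using (congrArg List.length h).ge)
    · rw [Term.subst, extend_of_ne hy] at h
      exact Or.inl (by simpa [Term.subst] using h.length_le)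
  | pre μ t ih =>
    cases k with
    | zero => exact Or.inl (Nat.zero_le _)
    | succ k =>
      rw [List.replicate_succ, Term.subst, completes_pre_cons] at h
      have := ih h.2
      simp only [Term.subst, Term.size]
      omega
  | add t u iht ihu =>
    cases k with
    | zero => exact Or.inl (Nat.zero_le _)
    | succ k =>
      rw [List.replicate_succ, Term.subst, completes_add_cons, ← List.replicate_succ] at h
      simp only [Term.subst, Term.size]
      rcases h with h | h
      · have := iht h; omega
      · have := ihu h; omega
  | par t u iht ihu =>
    obtain ⟨φ₁, φ₂, hm, h₁, h₂⟩ := completes_par.1 h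
    obtain ⟨i, j, rfl, rfl, rfl⟩ := hm.of_replicate
    have := iht h₁
    have := ihu h₂
    simp only [Term.subst, Term.size]
    omega

theorem lt_size_or_le_of_completes_word {a : A} (hab : a ≠ b) {t : Term A} {k : ℕ}
    (h : Completes (word a b k) (t.subst (extend σ x b n))) :
    k < (t.subst σ).size ∨ n ≤ k := by
  induction t generalizing k with
  | zero => simpa [length_word, Term.subst, Term.size] using h.length_le
  | var y =>
    by_cases hy : y = x
    · subst hy
      obtain ⟨μ, φ, e⟩ := List.exists_cons_of_length_eq_add_one (length_word a b k)
      rw [e, Term.subst, extend_self, completes_add_cons, completes_prePow_iff, ← e] at h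
      rcases h with h | h
      · exact Or.inl (by simpa [Term.subst, length_word] using h.length_le)
      · have := List.eq_of_mem_replicate (h ▸ show Act.name a ∈ word a b k by simp [word])
        rw [Act.name.injEq] at this
        exact absurd this hab
    · rw [Term.subst, extend_of_ne hy] at h
      exact Or.inl (by simpa [Term.subst, length_word] using h.length_le)
  | pre μ t ih =>
    cases k with
    | zero => exact Or.inl (by simp [Term.subst, Term.size])
    | succ k =>
      rw [word_succ, Term.subst, completes_pre_cons] at h
      have := ih h.2
      simp only [Term.subst, Term.size]
      omega
  | add t u iht ihu =>
    obtain ⟨μ, φ, e⟩ := List.exists_cons_of_length_eq_add_one (length_word a b k)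
    rw [e, Term.subst, completes_add_cons, ← e] at h
    simp only [Term.subst, Term.size]
    rcases h with h | h
    · have := iht h; omega
    · have := ihu h; omega
  | par t u iht ihu =>
    obtain ⟨φ₁, φ₂, hm, h₁, h₂⟩ := completes_par.1 h
    simp only [Term.subst, Term.size]
    obtain ⟨i, j, rfl, ⟨rfl, rfl⟩ | ⟨rfl, rfl⟩⟩ := hm.of_word
    · have := iht h₁
      have := le_size_or_le_of_completes_replicate h₂
      omega
    · have := le_size_or_le_of_completes_replicate h₁
      have := ihu h₂
      omega

theorem reach_var_of_completes_replicate (hx : ¬ Done (σ x)) {t : Term A}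
    (hn : (t.subst σ).size < n)
    (h : Completes (List.replicate n (Act.name b)) (t.subst (extend σ x b n))) :
    Reach σ t (var x) := by
  induction t with
  | zero =>
    have := h.length_le
    rw [List.length_replicate] at this
    simp only [Term.subst] at this hn
    omega
  | var y =>
    by_cases hy : y = x
    · subst hy; exact Reach.refl _
    · rw [Term.subst, extend_of_ne hy] at h
      have := h.length_le
      rw [List.length_replicate] at this
      simp only [Term.subst] at hn
      omega
  | pre μ t =>
    simp only [Term.subst, Term.size] at hn
    obtain ⟨m, rfl⟩ : ∃ m, n = m + 1 := ⟨n - 1, by omega⟩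
    -- After the prefix, the rest of the trace is one b too short for an added summand and too long
    -- to do without it.
    rw [List.replicate_succ, Term.subst, completes_pre_cons] at h
    have := le_size_or_le_of_completes_replicate h.2
    omega
  | add t u iht ihu =>
    simp only [Term.subst, Term.size] at hn
    obtain ⟨m, rfl⟩ : ∃ m, n = m + 1 := ⟨n - 1, by omega⟩
    rw [List.replicate_succ, Term.subst, completes_add_cons, ← List.replicate_succ] at h
    rcases h with h | h
    · exact Reach.addL (iht (by omega) h)
    · exact Reach.addR (ihu (by omega) h)
  | par t u iht ihu =>
    simp only [Term.subst, Term.size] at hn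
    obtain ⟨φ₁, φ₂, hm, h₁, h₂⟩ := completes_par.1 h
    obtain ⟨i, j, hij, rfl, rfl⟩ := hm.of_replicate
    have := le_size_or_le_of_completes_replicate h₁
    have := le_size_or_le_of_completes_replicate h₂
    -- The two sizes add up to less than n, so one component uses an added bⁿ, and this exhausts the
    -- trace.
    have hcase : (i = n ∧ j = 0) ∨ (i = 0 ∧ j = n) := by omega
    rcases hcase with ⟨rfl, rfl⟩ | ⟨rfl, rfl⟩
    · exact Reach.parL ((done_subst_extend hx).1 (completes_nil.1 h₂)) (iht (by omega) h₁)
    · exact Reach.parR ((done_subst_extend hx).1 (completes_nil.1 h₁)) (ihu (by omega) h₂)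

/-- The trace is too long to avoid an added bⁿ, and that summand is dead after its last b. So the
final a is performed by a component parallel to x, and that component does nothing else. -/
theorem exists_reach_par_of_completes_word {a : A} (hab : a ≠ b) (hx : ¬ Done (σ x)) {t : Term A}
    (hn : (t.subst σ).size < n)
    (h : Completes (word a b n) (t.subst (extend σ x b n))) :
    ∃ t₁ t₂, Reach σ t (par t₁ t₂) ∧
      ((CanFinish a (t₁.subst σ) ∧ Reach σ t₂ (var x)) ∨
        (Reach σ t₁ (var x) ∧ CanFinish a (t₂.subst σ))) := by
  induction t with
  | zero =>
    have := h.length_le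
    rw [length_word] at this
    simp only [Term.subst] at this hn
    omega
  | var y =>
    by_cases hy : y = x
    · subst hy
      obtain ⟨μ, φ, e⟩ := List.exists_cons_of_length_eq_add_one (length_word a b n)
      rw [e, Term.subst, extend_self, completes_add_cons, completes_prePow_iff, ← e] at h
      simp only [Term.subst] at hn
      have hl := length_word a b n
      rcases h with h | h
      · have := h.length_le
        omega
      · rw [h, List.length_replicate] at hl
        omega
    · rw [Term.subst, extend_of_ne hy] at h
      have := h.length_le
      rw [length_word] at this
      simp only [Term.subst] at hn
      omega
  | pre μ t =>
    simp only [Term.subst, Term.size] at hn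
    obtain ⟨m, rfl⟩ : ∃ m, n = m + 1 := ⟨n - 1, by omega⟩
    rw [word_succ, Term.subst, completes_pre_cons] at h
    have := lt_size_or_le_of_completes_word hab h.2
    omega
  | add t u iht ihu =>
    simp only [Term.subst, Term.size] at hn
    obtain ⟨μ, φ, e⟩ := List.exists_cons_of_length_eq_add_one (length_word a b n)
    rw [e, Term.subst, completes_add_cons, ← e] at h
    rcases h with h | h
    · obtain ⟨t₁, t₂, hr, h⟩ := iht (by omega) h
      exact ⟨t₁, t₂, Reach.addL hr, h⟩
    · obtain ⟨t₁, t₂, hr, h⟩ := ihu (by omega) h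
      exact ⟨t₁, t₂, Reach.addR hr, h⟩
  | par t u iht ihu =>
    simp only [Term.subst, Term.size] at hn
    obtain ⟨φ₁, φ₂, hm, h₁, h₂⟩ := completes_par.1 h
    obtain ⟨i, j, hij, ⟨rfl, rfl⟩ | ⟨rfl, rfl⟩⟩ := hm.of_word
    · have := lt_size_or_le_of_completes_word hab h₁
      have := le_size_or_le_of_completes_replicate h₂
      have hcase : (i = n ∧ j = 0) ∨ (i = 0 ∧ j = n) := by omega
      rcases hcase with ⟨rfl, rfl⟩ | ⟨rfl, rfl⟩
      · obtain ⟨t₁, t₂, hr, h⟩ := iht (by omega) h₁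
        exact ⟨t₁, t₂, Reach.parL ((done_subst_extend hx).1 (completes_nil.1 h₂)) hr, h⟩
      · exact ⟨t, u, Reach.refl _, Or.inl
          ⟨(canFinish_subst_extend hx hab).1 (completes_singleton.1 h₁),
            reach_var_of_completes_replicate hx (by omega) h₂⟩⟩
    · have := le_size_or_le_of_completes_replicate h₁
      have := lt_size_or_le_of_completes_word hab h₂
      have hcase : (i = 0 ∧ j = n) ∨ (i = n ∧ j = 0) := by omega
      rcases hcase with ⟨rfl, rfl⟩ | ⟨rfl, rfl⟩
      · obtain ⟨t₁, t₂, hr, h⟩ := ihu (by omega) h₂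
        exact ⟨t₁, t₂, Reach.parR ((done_subst_extend hx).1 (completes_nil.1 h₁)) hr, h⟩
      · exact ⟨t, u, Reach.refl _, Or.inr
          ⟨reach_var_of_completes_replicate hx (by omega) h₁,
            (canFinish_subst_extend hx hab).1 (completes_singleton.1 h₂)⟩⟩

end Extend

/-! ### Terms instantiated to `p_N` -/

/-- The trace sets reached by `b`-transitions of `p`. -/
def derivativeTraces (b : A) (p : Term A) : Set (Set (List (Act A))) :=
  {X | ∃ w, Step p (Act.name b) w ∧ X = traces w}

theorem Done.derivativeTraces_eq_empty {p : Term A} (hp : Done p) (b : A) :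
    derivativeTraces b p = ∅ := by
  ext X
  simp only [derivativeTraces, Set.mem_ofPred_eq, Set.mem_empty_iff_false, iff_false]
  rintro ⟨w, hw, -⟩
  exact hp _ _ hw

theorem PFEquiv.derivativeTraces_eq {p q : Term A} (h : PFEquiv p q) (b : A) :
    derivativeTraces b p = derivativeTraces b q := by
  ext X
  have := Set.ext_iff.1 h ([Act.name b], X)
  simp only [mem_possibleFutures, steps_singleton] at this
  exact this

/-- A term without summands that are variables has at most as many derivatives as its size, if it
is instantiated to a sum of processes `b ⋯ b a`. -/
theorem encard_derivativeTraces_le {a b : A} (hab : a ≠ b) {σ : ℕ → Term A} {t : Term A}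
    (hvar : ∀ x, Reach σ t (var x) → Done (σ x))
    (hstep : ∀ μ w, Step (t.subst σ) μ w →
      μ = Act.name b ∧ ∃ k, traces w = traces (prePow (Act.name b) k (act a))) :
    (derivativeTraces b (t.subst σ)).encard ≤ t.size := by
  induction t with
  | zero =>
    rw [Term.subst, done_zero.derivativeTraces_eq_empty]
    simp
  | var x =>
    rw [Term.subst, (hvar x (Reach.refl _)).derivativeTraces_eq_empty]
    simp
  | pre μ t =>
    have : derivativeTraces b ((pre μ t).subst σ) ⊆ {traces (t.subst σ)} := by
      rintro X ⟨w, hw, rfl⟩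
      cases hw
      rfl
    refine (Set.encard_le_encard this).trans ?_
    rw [Set.encard_singleton, Term.size]
    simp
  | add t u iht ihu =>
    have hsub : derivativeTraces b ((Term.add t u).subst σ) ⊆
        derivativeTraces b (t.subst σ) ∪ derivativeTraces b (u.subst σ) := by
      rintro X ⟨w, hw, rfl⟩
      cases hw with
      | addL hw => exact Or.inl ⟨w, hw, rfl⟩
      | addR hw => exact Or.inr ⟨w, hw, rfl⟩
    have h₁ := iht (fun x hx => hvar x (Reach.addL hx)) (fun μ w hw => hstep μ w (Step.addL hw))
    have h₂ := ihu (fun x hx => hvar x (Reach.addR hx)) (fun μ w hw => hstep μ w (Step.addR hw))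
    refine (Set.encard_le_encard hsub).trans ((Set.encard_union_le _ _).trans ?_)
    refine (add_le_add h₁ h₂).trans ?_
    rw [Term.size]
    push_cast
    exact le_self_add
  | par t u iht ihu =>
    have hle : t.size ≤ (par t u).size ∧ u.size ≤ (par t u).size := by
      simp only [Term.size]; omega
    by_cases ht : Done (t.subst σ)
    · rw [Term.subst, (pfEquiv_par_done_left ht : PFEquiv _ _).derivativeTraces_eq]
      refine (ihu (fun x hx => hvar x (Reach.parR ht hx)) (fun μ w hw => ?_)).trans
        (by exact_mod_cast hle.2)
      obtain ⟨h, k, e⟩ := hstep μ _ (Step.parR hw)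
      exact ⟨h, k, (traces_par_done_left ht).symm.trans e⟩
    by_cases hu : Done (u.subst σ)
    · rw [Term.subst, (pfEquiv_par_done_right hu : PFEquiv _ _).derivativeTraces_eq]
      refine (iht (fun x hx => hvar x (Reach.parL hu hx)) (fun μ w hw => ?_)).trans
        (by exact_mod_cast hle.1)
      obtain ⟨h, k, e⟩ := hstep μ _ (Step.parL hw)
      exact ⟨h, k, (traces_par_done_right hu).symm.trans e⟩
    -- Two active components are impossible: one of them could act after the other has completed
    -- some bⁱa, contrary to `hstep`.
    obtain ⟨μ, hμ⟩ := exists_singleton_mem_traces ht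
    obtain ⟨w, hw, -⟩ := cons_mem_traces.1 hμ
    obtain ⟨rfl, k, e⟩ := hstep μ _ (Step.parL hw)
    have hword : word a b (k + 1) ∈ traces ((par t u).subst σ) :=
      cons_mem_traces.2 ⟨_, Step.parL hw, e ▸ word_mem_traces_prePow a b k⟩
    obtain ⟨i, ν, h⟩ := exists_word_append_mem_traces_par ht hu hword
    exact absurd h (word_append_singleton_notMem hab hstep i ν)

/-- The instance of t has the traces of p_N, hence N distinct trace sets after b, one for each bⁱa.
Without an active variable summand it would have at most `t.size` of them. -/
theorem exists_reach_var_of_factor {a b : A} {N : ℕ} (hab : a ≠ b) (hN : 1 ≤ N) {r : Term A}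
    {σ : ℕ → Term A} {t : Term A} (hr : CanFinish a r)
    (h : properFutures (par r (t.subst σ)) ⊆ properFutures (target a b N)) (ht : t.size < N) :
    ∃ x, Reach σ t (var x) ∧ ¬ Done (σ x) := by
  by_contra! hvar
  have hstep : ∀ μ w, Step (t.subst σ) μ w →
      μ = Act.name b ∧ ∃ i < N, traces w = traces (prePow (Act.name b) i (act a)) :=
    fun μ w => traces_step_right_factor hab hN h hr
  have hle := encard_derivativeTraces_le hab hvar fun μ w hw =>
    have ⟨e, k, _, hk⟩ := hstep μ w hw
    ⟨e, k, hk⟩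
  set f : ℕ → Set (List (Act A)) := fun i => traces (prePow (Act.name b) i (act a)) with hf
  have hinj : Function.Injective f := by
    intro i j e
    have : word a b i ∈ f j := e ▸ word_mem_traces_prePow a b i
    rw [hf, mem_traces_prePow] at this
    exact (eq_of_word_append_prefix hab (ψ := []) (by simpa using this)).1
  have hsub : f '' (Finset.range N : Set ℕ) ⊆ derivativeTraces b (t.subst σ) := by
    rintro X ⟨i, hi, rfl⟩
    obtain ⟨w, hw, e⟩ := exists_step_of_traces_eq_pN hab (traces_right_factor hab h hr) hstep
      (by simpa using hi)
    exact ⟨w, hw, e.symm⟩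
  have := (Set.encard_le_encard hsub).trans hle
  rw [hinj.encard_image, Set.encard_coe_eq_coe_finsetCard, Finset.card_range] at this
  have : N ≤ t.size := by exact_mod_cast this
  omega

/-! ### Summands equivalent to `a ‖ p_N` -/

/-- The process `p` has a summand equivalent to `q`, up to terminated parallel components. -/
def HasSummand (q : Term A) : Term A → Prop
  | Term.add p p' => HasSummand q p ∨ HasSummand q p'
  | Term.par p p' => (Done p ∧ HasSummand q p') ∨ (Done p' ∧ HasSummand q p) ∨
      (¬ Done p ∧ ¬ Done p' ∧ PFEquiv (Term.par p p') q)
  | p => PFEquiv p q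

theorem HasSummand.properFutures_subset {p q : Term A} (h : HasSummand q p) :
    properFutures q ⊆ properFutures p := by
  induction p with
  | zero => exact (pfEquiv_iff.1 h).superset
  | var x => exact (pfEquiv_iff.1 h).superset
  | pre μ p => exact (pfEquiv_iff.1 h).superset
  | add p p' ih ih' =>
    rw [properFutures_add]
    rcases h with h | h
    · exact (ih h).trans Set.subset_union_left
    · exact (ih' h).trans Set.subset_union_right
  | par p p' ih ih' =>
    rcases h with ⟨hd, h⟩ | ⟨hd, h⟩ | ⟨-, -, h⟩
    · rw [pfEquiv_iff.1 (pfEquiv_par_done_left hd)]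
      exact ih' h
    · rw [pfEquiv_iff.1 (pfEquiv_par_done_right hd)]
      exact ih h
    · exact (pfEquiv_iff.1 h).superset

theorem HasSummand.of_reach {q : Term A} {σ : ℕ → Term A} {t v : Term A} (h : Reach σ t v)
    (hv : HasSummand q (v.subst σ)) : HasSummand q (t.subst σ) := by
  induction h with
  | refl => exact hv
  | addL _ ih => exact Or.inl (ih hv)
  | addR _ ih => exact Or.inr (ih hv)
  | parL hd _ ih => exact Or.inr (Or.inl ⟨hd, ih hv⟩)
  | parR hd _ ih => exact Or.inl ⟨hd, ih hv⟩

/-- The condition on parallel summands is needed because a component next to a terminated one may be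
a sum none of whose summands is equivalent to q. -/
theorem hasSummand_of_mem_summands {q p p' : Term A} (hp : p.Closed) (hp' : p' ∈ p.summands)
    (h : PFEquiv p' q)
    (hpar : ∀ r s, p' = par r s → ¬ PFEquiv r zero ∧ ¬ PFEquiv s zero) : HasSummand q p := by
  induction p with
  | zero => obtain rfl := hp'; exact h
  | var x => exact hp.elim
  | pre μ p => obtain rfl := hp'; exact h
  | add p₁ p₂ ih₁ ih₂ =>
    rcases hp' with hp' | hp'
    · exact Or.inl (ih₁ hp.1 hp')
    · exact Or.inr (ih₂ hp.2 hp')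
  | par p₁ p₂ =>
    obtain rfl := hp'
    have := hpar p₁ p₂ rfl
    rw [pfEquiv_zero_iff, pfEquiv_zero_iff] at this
    exact Or.inr (Or.inr ⟨this.1, this.2, h⟩)

/-- Peeling is undone by sandwiching: the futures of an enclosing parallel summand lie between those
of q and those of p. -/
theorem HasSummand.exists_mem_summands {q p : Term A} (h : HasSummand q p)
    (hle : properFutures p ⊆ properFutures q) : ∃ p' ∈ p.summands, PFEquiv p' q := by
  induction p with
  | zero => exact ⟨_, rfl, h⟩
  | var x => exact ⟨_, rfl, h⟩
  | pre μ p => exact ⟨_, rfl, h⟩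
  | add p₁ p₂ ih₁ ih₂ =>
    rw [properFutures_add, Set.union_subset_iff] at hle
    rcases h with h | h
    · obtain ⟨p', hp', e⟩ := ih₁ h hle.1
      exact ⟨p', Or.inl hp', e⟩
    · obtain ⟨p', hp', e⟩ := ih₂ h hle.2
      exact ⟨p', Or.inr hp', e⟩
  | par p₁ p₂ =>
    exact ⟨_, rfl, pfEquiv_iff.2 (hle.antisymm h.properFutures_subset)⟩

theorem not_pfEquiv_pre_target {a b : A} {N : ℕ} (hab : a ≠ b) (hN : 1 ≤ N) (μ : Act A)
    (p : Term A) : ¬ PFEquiv (pre μ p) (target a b N) := by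
  intro h
  have key : ∀ ν w, Step (target a b N) ν w → ν = μ := by
    intro ν w hs
    have : [ν] ∈ traces (pre μ p) := by
      rw [h.traces_eq]
      exact cons_mem_traces.2 ⟨w, hs, nil_mem_traces w⟩
    obtain ⟨v, hv, -⟩ := cons_mem_traces.1 this
    cases hv
    rfl
  have h₁ := key _ _ (Step.parL (Step.pre _ _))
  have h₂ := key _ _ (Step.parR (step_pN_iff.2 ⟨rfl, 0, by omega, rfl⟩))
  rw [← h₂, Act.name.injEq] at h₁
  exact hab h₁

theorem not_done_target (a b : A) (N : ℕ) : ¬ Done (target a b N) :=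
  fun h => not_done_pre _ _ (done_par.1 h).1

theorem HasSummand.exists_reach {a b : A} {N : ℕ} (hab : a ≠ b) (hN : 1 ≤ N)
    {σ : ℕ → Term A} {t : Term A} (h : HasSummand (target a b N) (t.subst σ)) :
    (∃ x, Reach σ t (var x) ∧ HasSummand (target a b N) (σ x)) ∨
      ∃ t₁ t₂, Reach σ t (par t₁ t₂) ∧ ¬ Done (t₁.subst σ) ∧ ¬ Done (t₂.subst σ) ∧
        PFEquiv (par (t₁.subst σ) (t₂.subst σ)) (target a b N) := by
  induction t with
  | zero => exact absurd (PFEquiv.done_iff h |>.1 done_zero) (not_done_target a b N)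
  | var x => exact Or.inl ⟨x, Reach.refl _, h⟩
  | pre μ t => exact absurd h (not_pfEquiv_pre_target hab hN _ _)
  | add t u iht ihu =>
    rcases h with h | h
    · rcases iht h with ⟨x, hr, hx⟩ | ⟨t₁, t₂, hr, h⟩
      · exact Or.inl ⟨x, Reach.addL hr, hx⟩
      · exact Or.inr ⟨t₁, t₂, Reach.addL hr, h⟩
    · rcases ihu h with ⟨x, hr, hx⟩ | ⟨t₁, t₂, hr, h⟩
      · exact Or.inl ⟨x, Reach.addR hr, hx⟩
      · exact Or.inr ⟨t₁, t₂, Reach.addR hr, h⟩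
  | par t u iht ihu =>
    rcases h with ⟨hd, h⟩ | ⟨hd, h⟩ | h
    · rcases ihu h with ⟨x, hr, hx⟩ | ⟨t₁, t₂, hr, h⟩
      · exact Or.inl ⟨x, Reach.parR hd hr, hx⟩
      · exact Or.inr ⟨t₁, t₂, Reach.parR hd hr, h⟩
    · rcases iht h with ⟨x, hr, hx⟩ | ⟨t₁, t₂, hr, h⟩
      · exact Or.inl ⟨x, Reach.parL hd hr, hx⟩
      · exact Or.inr ⟨t₁, t₂, Reach.parL hd hr, h⟩
    · exact Or.inr ⟨t, u, Reach.refl _, h⟩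

theorem Reach.completes_word {a b : A} {σ : ℕ → Term A} {x n : ℕ} (hab : a ≠ b)
    (hx : ¬ Done (σ x)) {t t₁ t₂ : Term A} (h : Reach σ t (par t₁ t₂))
    (h₁ : CanFinish a (t₁.subst σ)) (h₂ : Reach σ t₂ (var x)) :
    Completes (word a b (n + 1)) (t.subst (extend σ x b (n + 1))) := by
  refine h.completes hx (completes_par.2 ⟨_, _, (Merge.append _ _).symm, ?_,
    h₂.completes_replicate hx⟩)
  exact completes_singleton.2 ((canFinish_subst_extend hx hab).2 h₁)

theorem properFutures_par_comm_subset {a b : A} {N : ℕ} {r s : Term A}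
    (h : properFutures (par r s) ⊆ properFutures (target a b N)) :
    properFutures (par s r) ⊆ properFutures (target a b N) := by
  rwa [pfEquiv_iff.1 (pfEquiv_par_comm s r)]

theorem hasSummand_par_of_canFinish {a b : A} {N : ℕ} (hab : a ≠ b) (hN : 1 ≤ N) {r s : Term A}
    (h : properFutures (par r s) ⊆ properFutures (target a b N)) (hr : CanFinish a r) :
    ¬ Done r ∧ ¬ Done s ∧ PFEquiv (par r s) (target a b N) := by
  refine ⟨fun hd => ?_, fun hd => ?_, pfEquiv_target_of_canFinish hab hN h hr⟩
  · obtain ⟨r', hs, -⟩ := hr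
    exact hd _ _ hs
  · have hm : word a b (0 + 1) ∈ traces s :=
      traces_right_factor hab h hr ▸ word_mem_traces_pN a b (by omega)
    obtain ⟨w, hw⟩ := hm
    have := (hd.steps hw).1
    simp [word] at this

/-- Sound equations between terms smaller than `N` preserve summands equivalent to `a ‖ p_N`. -/
theorem SoundPF.hasSummand {a b : A} {N : ℕ} (hab : a ≠ b) (hN : 1 ≤ N) {t u : Term A}
    (hs : SoundPF t u) (ht : t.size < N) {σ : ℕ → Term A} (hσ : ∀ x, (σ x).Closed)
    (htar : PFEquiv (t.subst σ) (target a b N)) (h : HasSummand (target a b N) (t.subst σ)) :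
    HasSummand (target a b N) (u.subst σ) := by
  have hu : properFutures (u.subst σ) ⊆ properFutures (target a b N) := by
    rw [← pfEquiv_iff.1 (hs σ hσ), pfEquiv_iff.1 htar]
  -- The added summand will be bⁿ⁺¹, longer than any trace of the original instance of u.
  set n := (u.subst σ).size with hn
  have transfer : ∀ x φ, Completes φ (t.subst (extend σ x b (n + 1))) →
      Completes φ (u.subst (extend σ x b (n + 1))) := fun x φ =>
    (hs _ (closed_extend hσ x b (n + 1))).completes
  rcases h.exists_reach hab hN with ⟨x, hr, hx⟩ | ⟨t₁, t₂, hr, hd₁, hd₂, he⟩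
  · have hd : ¬ Done (σ x) := fun hd => not_done_target a b N fun μ w hw => by
      have : ([μ], traces w) ∈ properFutures (target a b N) :=
        ⟨⟨w, steps_singleton.2 hw, rfl⟩, by simp⟩
      obtain ⟨⟨v, hv, -⟩, -⟩ := hx.properFutures_subset this
      exact hd _ _ (steps_singleton.1 hv)
    exact HasSummand.of_reach (reach_var_of_completes_replicate hd (Nat.lt_succ_self n)
      (transfer x _ (hr.completes_replicate hd))) hx
  · have key : ∃ x, ¬ Done (σ x) ∧
        Completes (word a b (n + 1)) (t.subst (extend σ x b (n + 1))) := by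
      have hsize := hr.size_le
      simp only [Term.size] at hsize
      rcases canFinish_or_of_pfEquiv_target hab hN he hd₁ hd₂ with hc | hc
      · obtain ⟨x, hx, hd⟩ := exists_reach_var_of_factor hab hN hc (pfEquiv_iff.1 he).subset
          (by omega)
        exact ⟨x, hd, hr.completes_word hab hd hc hx⟩
      · obtain ⟨x, hx, hd⟩ := exists_reach_var_of_factor hab hN hc
          (properFutures_par_comm_subset (pfEquiv_iff.1 he).subset) (by omega)
        refine ⟨x, hd, hr.completes hd (completes_par.2 ⟨_, _, Merge.append _ _,
          hx.completes_replicate hd, ?_⟩)⟩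
        exact completes_singleton.2 ((canFinish_subst_extend hd hab).2 hc)
    obtain ⟨x, hd, hc⟩ := key
    obtain ⟨u₁, u₂, hru, h⟩ :=
      exists_reach_par_of_completes_word hab hd (Nat.lt_succ_self n) (transfer x _ hc)
    -- Nothing more than this inclusion is known about the composition found in u; its factor that
    -- terminates by a upgrades it to equivalence.
    have hsub := hru.properFutures_subset.trans hu
    refine HasSummand.of_reach hru (Or.inr (Or.inr ?_))
    rcases h with ⟨h, -⟩ | ⟨-, h⟩
    · exact hasSummand_par_of_canFinish hab hN hsub h
    · obtain ⟨h₂, h₁, e⟩ :=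
        hasSummand_par_of_canFinish hab hN (properFutures_par_comm_subset hsub) h
      exact ⟨h₁, h₂, (pfEquiv_par_comm _ _).trans e⟩

/-! ### Derivations -/

theorem subst_subst (σ τ : ℕ → Term A) (t : Term A) :
    (t.subst τ).subst σ = t.subst fun x => (τ x).subst σ := by
  induction t <;> simp_all [Term.subst]

theorem Closed.subst {σ : ℕ → Term A} (hσ : ∀ x, (σ x).Closed) (t : Term A) :
    (t.subst σ).Closed := by
  induction t with
  | zero => trivial
  | var x => exact hσ x
  | pre _ _ ih => exact ih
  | add _ _ ih ih' => exact ⟨ih, ih'⟩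
  | par _ _ ih ih' => exact ⟨ih, ih'⟩

theorem Closed.subst_eq {t : Term A} (ht : t.Closed) (σ : ℕ → Term A) : t.subst σ = t := by
  induction t with
  | zero => rfl
  | var x => exact ht.elim
  | pre _ _ ih => rw [Term.subst, ih ht]
  | add _ _ ih ih' => rw [Term.subst, ih ht.1, ih' ht.2]
  | par _ _ ih ih' => rw [Term.subst, ih ht.1, ih' ht.2]

theorem Derivable.soundPF {E : Set (Term A × Term A)} (hE : ∀ e ∈ E, SoundPF e.1 e.2)
    {t u : Term A} (h : Derivable E t u) : SoundPF t u := by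
  induction h with
  | ax h => exact hE _ h
  | addComm t u =>
    intro σ _
    rw [pfEquiv_iff, Term.subst, Term.subst, properFutures_add, properFutures_add, Set.union_comm]
  | addAssoc t u v =>
    intro σ _
    rw [pfEquiv_iff]
    simp only [Term.subst, properFutures_add, Set.union_assoc]
  | refl t => exact fun σ _ => PFEquiv.refl _
  | symm _ ih => exact fun σ hσ => (ih σ hσ).symm
  | trans _ _ ih ih' => exact fun σ hσ => (ih σ hσ).trans (ih' σ hσ)
  | subst τ _ ih =>
    intro σ hσ
    rw [subst_subst, subst_subst]
    exact ih _ fun x => Closed.subst hσ (τ x)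
  | pre μ _ ih => exact fun σ hσ => (ih σ hσ).pre μ
  | add _ _ ih ih' => exact fun σ hσ => (ih σ hσ).add (ih' σ hσ)
  | par _ _ ih ih' => exact fun σ hσ => (ih σ hσ).par (ih' σ hσ)

theorem HasSummand.pfEquiv_of_subset {p q : Term A} (h : HasSummand q p)
    (hle : properFutures p ⊆ properFutures q) : PFEquiv p q :=
  pfEquiv_iff.2 (hle.antisymm h.properFutures_subset)

/-- A part of the sum that satisfies `HasSummand q` has its futures squeezed between q and the whole
sum, so it is itself equivalent to q. Hence the implications need only be assumed for parts
equivalent to q. -/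
theorem HasSummand.add_congr {q p₁ p₂ p₁' p₂' : Term A}
    (h₁ : PFEquiv p₁ q → HasSummand q p₁ → HasSummand q p₁')
    (h₂ : PFEquiv p₂ q → HasSummand q p₂ → HasSummand q p₂')
    (hq : PFEquiv (Term.add p₁ p₂) q) (h : HasSummand q (Term.add p₁ p₂)) :
    HasSummand q (Term.add p₁' p₂') := by
  have hle := (pfEquiv_iff.1 hq).subset
  rw [properFutures_add, Set.union_subset_iff] at hle
  rcases h with h | h
  · exact Or.inl (h₁ (h.pfEquiv_of_subset hle.1) h)
  · exact Or.inr (h₂ (h.pfEquiv_of_subset hle.2) h)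

theorem HasSummand.par_congr {q p₁ p₂ p₁' p₂' : Term A} (e₁ : PFEquiv p₁ p₁')
    (e₂ : PFEquiv p₂ p₂') (h₁ : PFEquiv p₁ q → HasSummand q p₁ → HasSummand q p₁')
    (h₂ : PFEquiv p₂ q → HasSummand q p₂ → HasSummand q p₂')
    (hq : PFEquiv (Term.par p₁ p₂) q) (h : HasSummand q (Term.par p₁ p₂)) :
    HasSummand q (Term.par p₁' p₂') := by
  rcases h with ⟨hd, h⟩ | ⟨hd, h⟩ | ⟨hd₁, hd₂, h⟩
  · exact Or.inl ⟨e₁.done_iff.1 hd, h₂ ((pfEquiv_par_done_left hd).symm.trans hq) h⟩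
  · exact Or.inr (Or.inl ⟨e₂.done_iff.1 hd, h₁ ((pfEquiv_par_done_right hd).symm.trans hq) h⟩)
  · exact Or.inr (Or.inr ⟨fun hd => hd₁ (e₁.done_iff.2 hd), fun hd => hd₂ (e₂.done_iff.2 hd),
      (e₁.par e₂).symm.trans h⟩)

/-- Derivations from sound equations smaller than `N` preserve summands equivalent to
`a ‖ p_N`. -/
theorem Derivable.hasSummand_iff {a b : A} (hab : a ≠ b) {E : Set (Term A × Term A)}
    (hE : ∀ e ∈ E, SoundPF e.1 e.2) {N : ℕ} (hN : 1 ≤ N)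
    (hsize : ∀ e ∈ E, e.1.size < N ∧ e.2.size < N) {t u : Term A} (h : Derivable E t u)
    {σ : ℕ → Term A} (hσ : ∀ x, (σ x).Closed) (ht : PFEquiv (t.subst σ) (target a b N)) :
    HasSummand (target a b N) (t.subst σ) ↔ HasSummand (target a b N) (u.subst σ) := by
  have sound : ∀ {t u : Term A}, Derivable E t u → ∀ {σ : ℕ → Term A}, (∀ x, (σ x).Closed) →
      PFEquiv (u.subst σ) (t.subst σ) := fun h σ hσ => (h.soundPF hE σ hσ).symm
  induction h generalizing σ with
  | @ax t u h =>
    have hs := hE _ h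
    exact ⟨hs.hasSummand hab hN (hsize _ h).1 hσ ht,
      SoundPF.hasSummand hab hN (fun σ hσ => (hs σ hσ).symm) (hsize _ h).2 hσ
        ((hs σ hσ).symm.trans ht)⟩
  | addComm t u => exact Or.comm
  | addAssoc t u v => exact or_assoc
  | refl t => exact Iff.rfl
  | symm h ih => exact (ih hσ ((sound h hσ).symm.trans ht)).symm
  | trans h _ ih ih' => exact (ih hσ ht).trans (ih' hσ ((sound h hσ).trans ht))
  | subst τ _ ih =>
    rw [subst_subst] at ht
    rw [subst_subst, subst_subst]
    exact ih (fun x => Closed.subst hσ (τ x)) ht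
  | pre μ h =>
    refine iff_of_false (not_pfEquiv_pre_target hab hN _ _) (not_pfEquiv_pre_target hab hN _ _)
  | add h₁ h₂ ih₁ ih₂ =>
    have e := ((sound h₁ hσ).add (sound h₂ hσ)).trans ht
    exact ⟨HasSummand.add_congr (fun h => (ih₁ hσ h).1) (fun h => (ih₂ hσ h).1) ht,
      HasSummand.add_congr (fun h => (ih₁ hσ ((sound h₁ hσ).symm.trans h)).2)
        (fun h => (ih₂ hσ ((sound h₂ hσ).symm.trans h)).2) e⟩
  | par h₁ h₂ ih₁ ih₂ =>
    have e := ((sound h₁ hσ).par (sound h₂ hσ)).trans ht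
    exact ⟨HasSummand.par_congr (sound h₁ hσ).symm (sound h₂ hσ).symm
        (fun h => (ih₁ hσ h).1) (fun h => (ih₂ hσ h).1) ht,
      HasSummand.par_congr (sound h₁ hσ) (sound h₂ hσ)
        (fun h => (ih₁ hσ ((sound h₁ hσ).symm.trans h)).2)
        (fun h => (ih₂ hσ ((sound h₂ hσ).symm.trans h)).2) e⟩

end CCS

theorem mainTheorem8 {A : Type*} (a b : A) (hab : a ≠ b)
    (E : Set (CCS.Term A × CCS.Term A)) (hfin : E.Finite)
    (hsound : ∀ e ∈ E, CCS.SoundPF e.1 e.2)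
    (N : ℕ) (hN : 1 ≤ N) (hsize : ∀ e ∈ E, e.1.size < N ∧ e.2.size < N)
    (p q : CCS.Term A) (hp : p.Closed) (hq : q.Closed)
    (hpN : CCS.PFEquiv p (CCS.Term.par (CCS.act a) (CCS.pN a b N)))
    (hqN : CCS.PFEquiv q (CCS.Term.par (CCS.act a) (CCS.pN a b N)))
    (hpq : CCS.Derivable E p q)
    (hsummand : ∃ p' ∈ p.summands,
      CCS.PFEquiv p' (CCS.Term.par (CCS.act a) (CCS.pN a b N)) ∧
      ∀ r s, p' = CCS.Term.par r s →
        ¬ CCS.PFEquiv r CCS.Term.zero ∧ ¬ CCS.PFEquiv s CCS.Term.zero) :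
    ∃ q' ∈ q.summands, CCS.PFEquiv q' (CCS.Term.par (CCS.act a) (CCS.pN a b N)) := by
  obtain ⟨p', hp', e, hpar⟩ := hsummand
  -- Derivations may pass through open terms, so the invariant is stated for closed instances; since
  -- p and q are closed, any closed substitution serves.
  have hσ : ∀ _ : ℕ, (CCS.Term.zero : CCS.Term A).Closed := fun _ => trivial
  have h := hpq.hasSummand_iff hab hsound hN hsize hσ (by rwa [CCS.Closed.subst_eq hp])
  rw [CCS.Closed.subst_eq hp, CCS.Closed.subst_eq hq] at h
  exact (h.1 (CCS.hasSummand_of_mem_summands hp hp' e hpar)).exists_mem_summands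
    (CCS.pfEquiv_iff.1 hqN).subset
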